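/- Let $\Gamma=\pi_1(S,x)$ be the fundamental group of a closed (compact, connected, without boundary) oriented smooth surface $S$, let $d$ be a natural number, and let $\rho,\rho':\Gamma\to \mathrm{PSL}(d,\mathbb C)$ be representations such that for every $\gamma\in\Gamma\setminus\{1\}$ both $\rho(\gamma)$ and $\rho'(\gamma)$ are diagonalizable with eigenvalues of pairwise distinct moduli. For $g\in\mathrm{PSL}(d,\mathbb C)$ let $\lambda^1(g),\dots,\lambda^d(g)$ be the eigenvalues of a lift of $g$ to $\mathrm{SL}(d,\mathbb C)$, with multiplicity and ordered so that their moduli are non-increasing; when these moduli are pairwise distinct, and for $g=1$, the ratios $\lambda^j(g)/\lambda^{j+1}(g)$ do not depend on the choices. Suppose that $$\frac{\lambda^j(\rho(\gamma))}{\lambda^{j+1}(\rho(\gamma))}=\frac{\lambda^j(\rho'(\gamma))}{\lambda^{j+1}(\rho'(\gamma))}$$ for every $\gamma\in\Gamma$ and every $1\le j\le d-1$. Then: (1) $\rho$ and $\rho'$ define the same point of the character variety $\mathrm{Hom}(\Gamma,\mathrm{PSL}(d,\mathbb C))/\!\!/\mathrm{PSL}(d,\mathbb C)$, i.e. every conjugation-invariant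 regular function on the representation variety $\mathrm{Hom}(\Gamma,\mathrm{PSL}(d,\mathbb C))$ takes the same value at $\rho$ and $\rho'$. (2) If moreover $\rho$ and $\rho'$ are completely reducible (every $\rho(\Gamma)$-invariant linear subspace of $\mathbb C^d$ has a $\rho(\Gamma)$-invariant complement, and likewise for $\rho'$), then $\rho$ and $\rho'$ are conjugate: there is $M\in\mathrm{PSL}(d,\mathbb C)$ with $\rho'(\gamma)=M\rho(\gamma)M^{-1}$ for all $\gamma\in\Gamma$. -/

import Mathlib

open scoped Manifold ContDiff

namespace SurfaceRep

/-! ### Closed oriented surfaces -/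

/-- A smooth surface is orientable if it has a subatlas of its smooth structure all of whose
transition maps have positive Jacobian determinant. -/
def IsOrientable (S : Type*) [TopologicalSpace S] [ChartedSpace (EuclideanSpace ℝ (Fin 2)) S] :
    Prop :=
  ∃ 𝒜 : Set (OpenPartialHomeomorph S (EuclideanSpace ℝ (Fin 2))),
    𝒜 ⊆ IsManifold.maximalAtlas (𝓡 2) ∞ S ∧
    (∀ x : S, ∃ e ∈ 𝒜, x ∈ e.source) ∧
    ∀ e ∈ 𝒜, ∀ e' ∈ 𝒜, ∀ y ∈ (e.symm ≫ₕ e').source,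
      0 < (fderiv ℝ (e.symm ≫ₕ e') y).det

/-! ### Elements of `PSL(d, ℂ)` and their eigenvalues -/

/-- `SL(d, ℂ)`. -/
abbrev SLC (d : ℕ) : Type := Matrix.SpecialLinearGroup (Fin d) ℂ

/-- `PSL(d, ℂ)`, the quotient of `SL(d, ℂ)` by its centre. -/
abbrev PSLC (d : ℕ) : Type := Matrix.ProjectiveSpecialLinearGroup (Fin d) ℂ

/-- The projection `SL(d, ℂ) → PSL(d, ℂ)`. -/
def proj (d : ℕ) : SLC d →* PSLC d := QuotientGroup.mk' (Subgroup.center (SLC d))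

/-- `g ∈ PSL(d, ℂ)` is diagonalizable with eigenvalues of pairwise distinct moduli: it has a lift
`A ∈ SL(d, ℂ)` with `A = P · diag(l) · P⁻¹` and `|l₁|, …, |l_d|` pairwise distinct. (Lifts differ
by scalars of modulus one, so the choice of the lift is immaterial.) -/
def HasDistinctModuli {d : ℕ} (g : PSLC d) : Prop :=
  ∃ A : SLC d, proj d A = g ∧ ∃ (P : GL (Fin d) ℂ) (l : Fin d → ℂ),
    Function.Injective (fun j => ‖l j‖) ∧
    (A : Matrix (Fin d) (Fin d) ℂ) =
      (P : Matrix (Fin d) (Fin d) ℂ) * Matrix.diagonal l * ((P⁻¹ : GL (Fin d) ℂ) : Matrix _ _ ℂ)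

/-- `l` lists the eigenvalues of `A` with multiplicity, in an order of non-increasing modulus. -/
def IsEigenvalueList {d : ℕ} (A : Matrix (Fin d) (Fin d) ℂ) (l : Fin d → ℂ) : Prop :=
  Antitone (fun j => ‖l j‖) ∧ Finset.univ.val.map l = A.charpoly.roots

theorem exists_isEigenvalueList {d : ℕ} (A : Matrix (Fin d) (Fin d) ℂ) :
    ∃ l : Fin d → ℂ, IsEigenvalueList A l := by
  have hlen : A.charpoly.roots.toList.length = d := by
    rw [Multiset.length_toList, IsAlgClosed.card_roots_eq_natDegree,
      Matrix.charpoly_natDegree_eq_dim, Fintype.card_fin]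
  obtain ⟨f, hf⟩ : ∃ f : Fin d → ℂ, Finset.univ.val.map f = A.charpoly.roots := by
    refine ⟨fun i => A.charpoly.roots.toList.get (Fin.cast hlen.symm i), ?_⟩
    conv_rhs => rw [← Multiset.coe_toList A.charpoly.roots]
    rw [Fin.univ_val_map]
    congr 1
    apply List.ext_get
    · simp [hlen]
    · intro n h1 h2
      simp
  refine ⟨f ∘ Tuple.sort (fun j => -‖f j‖), ?_, ?_⟩
  · intro i j hij
    have := Tuple.monotone_sort (fun j => -‖f j‖) hij
    simpa using this
  · rw [← Multiset.map_map, Multiset.map_univ_val_equiv, hf]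

/-- The eigenvalues `λ¹(g), …, λᵈ(g)` (indexed from `0`) of a lift of `g ∈ PSL(d, ℂ)` to
`SL(d, ℂ)`, with multiplicity and ordered by non-increasing modulus. Another lift multiplies all of
them by the same root of unity. -/
noncomputable def eigenvalue {d : ℕ} (g : PSLC d) : Fin d → ℂ :=
  Classical.choose (exists_isEigenvalueList (Quotient.out g : SLC d).1)

/-- The `j`-th eigenvalue gap, the ratio of the `j`-th to the `(j+1)`-st eigenvalue; indices start
from `0`, so `j` runs over the naturals with `j + 1 < d`. -/
noncomputable def gap {d : ℕ} (g : PSLC d) (j : ℕ) (hj : j + 1 < d) : ℂ :=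
  eigenvalue g ⟨j, Nat.lt_of_succ_lt hj⟩ / eigenvalue g ⟨j + 1, hj⟩

/-- A list of eigenvalues is determined by the matrix when the moduli are distinct. -/
theorem IsEigenvalueList.eq_of_diagonalization {d : ℕ} {A : Matrix (Fin d) (Fin d) ℂ}
    {m : Fin d → ℂ} (hm : IsEigenvalueList A m) (P : GL (Fin d) ℂ) (l : Fin d → ℂ)
    (hl : StrictAnti (fun j => ‖l j‖))
    (hA : A = (P : Matrix (Fin d) (Fin d) ℂ) * Matrix.diagonal l *
      ((P⁻¹ : GL (Fin d) ℂ) : Matrix _ _ ℂ)) : m = l := by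
  have hroots : A.charpoly.roots = Finset.univ.val.map l := by
    rw [hA, Matrix.coe_units_inv, Matrix.charpoly_units_conj, Matrix.charpoly_diagonal]
    have h := Polynomial.roots_multiset_prod_X_sub_C (Finset.univ.val.map l)
    rwa [Multiset.map_map] at h
  have hperm : (List.ofFn m).Perm (List.ofFn l) := by
    have h := hm.2.trans hroots
    rwa [Fin.univ_val_map, Fin.univ_val_map, Multiset.coe_eq_coe] at h
  refine List.ofFn_injective (hperm.eq_of_pairwise (le := fun a b => ‖b‖ ≤ ‖a‖) ?_ ?_ ?_)
  · intro a b ha hb h1 h2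
    obtain ⟨i, rfl⟩ := List.mem_ofFn.1 (hperm.mem_iff.1 ha)
    obtain ⟨k, rfl⟩ := List.mem_ofFn.1 hb
    rw [hl.injective (le_antisymm h2 h1)]
  · exact List.pairwise_ofFn.2 fun i k hik => hm.1 hik.le
  · exact List.pairwise_ofFn.2 fun i k hik => hl.antitone hik.le

/-- The gaps do not depend on the choices made: they can be read off from any lift of `g` and any
diagonalization of it with strictly decreasing moduli. -/
theorem gap_eq {d : ℕ} (A : SLC d) (P : GL (Fin d) ℂ) (l : Fin d → ℂ)
    (hl : StrictAnti (fun j => ‖l j‖))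
    (hA : (A : Matrix (Fin d) (Fin d) ℂ) =
      (P : Matrix (Fin d) (Fin d) ℂ) * Matrix.diagonal l * ((P⁻¹ : GL (Fin d) ℂ) : Matrix _ _ ℂ))
    (j : ℕ) (hj : j + 1 < d) :
    gap (proj d A) j hj = l ⟨j, Nat.lt_of_succ_lt hj⟩ / l ⟨j + 1, hj⟩ := by
  set B : SLC d := Quotient.out (proj d A) with hB
  have hBA : proj d B = proj d A := Quotient.out_eq _
  have hz : A⁻¹ * B ∈ Subgroup.center (SLC d) := QuotientGroup.eq.1 hBA.symm
  obtain ⟨c, hc, hcz⟩ := Matrix.SpecialLinearGroup.mem_center_iff.1 hz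
  have hc0 : c ≠ 0 := by
    rintro rfl
    rw [Fintype.card_fin, zero_pow (by omega)] at hc
    exact zero_ne_one hc
  have hBm : (B : Matrix (Fin d) (Fin d) ℂ) = (P : Matrix (Fin d) (Fin d) ℂ) *
      Matrix.diagonal (fun j => c * l j) * ((P⁻¹ : GL (Fin d) ℂ) : Matrix _ _ ℂ) := by
    have h1 : (B : Matrix (Fin d) (Fin d) ℂ) = c • (A : Matrix (Fin d) (Fin d) ℂ) := by
      have h2 : B = A * (A⁻¹ * B) := by group
      rw [h2, Matrix.SpecialLinearGroup.coe_mul, ← hcz]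
      ext a b
      simp [mul_comm]
    have h3 : Matrix.diagonal (fun j => c * l j) = c • Matrix.diagonal l := by
      ext a b
      by_cases h : a = b <;> simp [h]
    rw [h1, h3, hA]
    simp
  have key : eigenvalue (proj d A) = fun j => c * l j := by
    refine IsEigenvalueList.eq_of_diagonalization
      (Classical.choose_spec (exists_isEigenvalueList B.1)) P _ ?_ hBm
    intro a b hab
    simp only [norm_mul]
    exact mul_lt_mul_of_pos_left (hl hab) (norm_pos_iff.2 hc0)
  unfold gap
  rw [key]
  exact mul_div_mul_left _ _ hc0

/-! ### Representations into `PSL(d, ℂ)` -/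

variable {Γ : Type*} [Group Γ] {d : ℕ}

/-- The representation `γ ↦ M ρ(γ) M⁻¹`. -/
def conjRep (M : PSLC d) (ρ : Γ →* PSLC d) : Γ →* PSLC d :=
  (MulAut.conj M).toMonoidHom.comp ρ

/-- A linear subspace of `ℂᵈ` is invariant under `ρ` if every lift to `SL(d, ℂ)` of every `ρ(γ)`
maps it into itself. -/
def IsInvariantSubspace (ρ : Γ →* PSLC d) (W : Submodule ℂ (Fin d → ℂ)) : Prop :=
  ∀ (γ : Γ) (A : SLC d), proj d A = ρ γ → W ≤ W.comap (Matrix.toLin' A.1)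

/-- `ρ` is completely reducible: every invariant subspace has an invariant complement. -/
def IsCompletelyReducible (ρ : Γ →* PSLC d) : Prop :=
  ∀ W, IsInvariantSubspace ρ W → ∃ W', IsInvariantSubspace ρ W' ∧ IsCompl W W'

/-- Regular functions on the affine variety `PSL(d, ℂ)`: those that lift to polynomials in the
matrix entries on `SL(d, ℂ)`. -/
def IsRegularPSL (f : PSLC d → ℂ) : Prop :=
  ∃ p : MvPolynomial (Fin d × Fin d) ℂ,
    ∀ A : SLC d, f (proj d A) = MvPolynomial.eval (fun ij => A.1 ij.1 ij.2) p

variable (Γ d) in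
/-- The algebra of regular functions on the representation variety `Hom(Γ, PSL(d, ℂ))`, generated by
the functions `ρ ↦ f(ρ(γ))` with `γ ∈ Γ` and `f` regular on `PSL(d, ℂ)`. -/
noncomputable def regularFunctions : Subalgebra ℂ ((Γ →* PSLC d) → ℂ) :=
  Algebra.adjoin ℂ {F | ∃ (γ : Γ) (f : PSLC d → ℂ), IsRegularPSL f ∧ F = fun ρ => f (ρ γ)}

/-- `ρ` and `ρ'` define the same point of the character variety
`Hom(Γ, PSL(d, ℂ)) // PSL(d, ℂ)` (the quotient of geometric invariant theory): every
conjugation-invariant regular function on `Hom(Γ, PSL(d, ℂ))` takes the same value at both. -/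
def SameCharacterPoint (ρ ρ' : Γ →* PSLC d) : Prop :=
  ∀ F ∈ regularFunctions Γ d, (∀ (M : PSLC d) (σ : Γ →* PSLC d), F (conjRep M σ) = F σ) →
    F ρ = F ρ'

/-- `ρ` and `ρ'` are conjugate by an element of `PSL(d, ℂ)`. -/
def AreConjugate (ρ ρ' : Γ →* PSLC d) : Prop :=
  ∃ M : PSLC d, ρ' = conjRep M ρ

end SurfaceRep

/-! Choose lifts `A`, `A'` of `ρ γ`, `ρ' γ` to `SL(d, ℂ)`. Equal gaps make the two ordered
eigenvalue lists proportional, and both determinants are one, so the characteristic polynomials of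
`A` and `ζ • A'` agree for some `ζ` with `ζ ^ d = 1`. The main difficulty is that `ζ` varies with
the pair.

To remove it, consider the group `K` of all pairs of lifts (`liftPairs`) with its Zariski topology.
It is covered by finitely many closed sets, one for each root of unity. The irreducible component of
the identity is a subgroup `H` containing a positive power of every element; being irreducible, it
lies in a single one of these sets, and the identity forces `ζ = 1` there
(`exists_subgroup_charpoly_eq`).

On `H` characteristic polynomials agree, hence so do traces, also on the algebra of pairs of
matrices spanned by `H`. A pair in `H` coming from a nontrivial `γ` can be diagonalized to the same
diagonal matrix with distinct entries on both sides, so in suitable bases the algebra contains the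
diagonal idempotents. Equal traces then say that products of matrix coefficients around closed loops
of indices agree. If both representations are completely reducible, this yields a diagonal matrix
intertwining the two projections of `H` (`exists_diagonal_intertwiner`, `exists_intertwiner`).

Passing between `K` and `H` costs nothing: if the eigenvalues of `A` have distinct moduli, `A` is a
polynomial in `A ^ n`. So subspaces invariant under powers are invariant, and an intertwiner of
powers intertwines the elements up to a root of unity, which disappears in `PSL`. This proves
conjugacy (`areConjugate_of_gap_eq`).

Without complete reducibility, each representation is replaced by its semisimplification, a limit of
conjugates with the same characteristic polynomials (`exists_semisimplification`). Invariant regular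
functions do not see the change, and the completely reducible case applies to the limits. -/

namespace SurfaceRep

/-! ### Diagonalizable matrices -/

section Diagonalization

variable {d : ℕ}

/-- Conjugation by an invertible matrix, as an algebra endomorphism. -/
noncomputable def conjMat (P : GL (Fin d) ℂ) :
    Matrix (Fin d) (Fin d) ℂ →ₐ[ℂ] Matrix (Fin d) (Fin d) ℂ where
  toFun A := (P : Matrix (Fin d) (Fin d) ℂ) * A * ((P⁻¹ : GL (Fin d) ℂ) : Matrix _ _ ℂ)
  map_one' := by simp
  map_zero' := by simp
  map_mul' A B := by
    have h : ((P⁻¹ : GL (Fin d) ℂ) : Matrix (Fin d) (Fin d) ℂ) * P = 1 := by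
      rw [← Units.val_mul, inv_mul_cancel, Units.val_one]
    simp only [Matrix.mul_assoc]
    rw [← Matrix.mul_assoc _ (P : Matrix (Fin d) (Fin d) ℂ), h, Matrix.one_mul]
  map_add' A B := by rw [Matrix.mul_add, Matrix.add_mul]
  commutes' c := by
    simp only [Algebra.algebraMap_eq_smul_one, Matrix.mul_smul, Matrix.smul_mul, mul_one]
    rw [← Units.val_mul, mul_inv_cancel, Units.val_one]

theorem conjMat_apply (P : GL (Fin d) ℂ) (A : Matrix (Fin d) (Fin d) ℂ) :
    conjMat P A =
      (P : Matrix (Fin d) (Fin d) ℂ) * A * ((P⁻¹ : GL (Fin d) ℂ) : Matrix _ _ ℂ) := rfl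

theorem conjMat_mul (P Q : GL (Fin d) ℂ) (A : Matrix (Fin d) (Fin d) ℂ) :
    conjMat (P * Q) A = conjMat P (conjMat Q A) := by
  simp only [conjMat_apply, mul_inv_rev, Units.val_mul, Matrix.mul_assoc]

theorem conjMat_one (A : Matrix (Fin d) (Fin d) ℂ) : conjMat 1 A = A := by
  simp [conjMat_apply]

@[simp]
theorem conjMat_inv_conjMat (P : GL (Fin d) ℂ) (A : Matrix (Fin d) (Fin d) ℂ) :
    conjMat P⁻¹ (conjMat P A) = A := by
  rw [← conjMat_mul, inv_mul_cancel, conjMat_one]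

@[simp]
theorem conjMat_conjMat_inv (P : GL (Fin d) ℂ) (A : Matrix (Fin d) (Fin d) ℂ) :
    conjMat P (conjMat P⁻¹ A) = A := by
  rw [← conjMat_mul, mul_inv_cancel, conjMat_one]

theorem charpoly_conjMat (P : GL (Fin d) ℂ) (A : Matrix (Fin d) (Fin d) ℂ) :
    (conjMat P A).charpoly = A.charpoly := by
  rw [conjMat_apply, Matrix.coe_units_inv, Matrix.charpoly_units_conj]

theorem trace_conjMat (P : GL (Fin d) ℂ) (A : Matrix (Fin d) (Fin d) ℂ) :
    (conjMat P A).trace = A.trace := by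
  rw [conjMat_apply, Matrix.trace_units_conj]

theorem det_conjMat (P : GL (Fin d) ℂ) (A : Matrix (Fin d) (Fin d) ℂ) :
    (conjMat P A).det = A.det := by
  rw [conjMat_apply, Matrix.det_units_conj]

theorem aeval_diagonal (l : Fin d → ℂ) (q : Polynomial ℂ) :
    Polynomial.aeval (Matrix.diagonal l) q = Matrix.diagonal (fun i => q.eval (l i)) := by
  have h := Polynomial.aeval_algHom_apply (Matrix.diagonalAlgHom (n := Fin d) (α := ℂ) ℂ) l q
  have h2 : Polynomial.aeval l q = fun i => q.eval (l i) := by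
    funext i
    rw [Polynomial.aeval_pi_apply]
    simp
  rw [h2] at h
  simpa using h

theorem aeval_conjMat_diagonal (P : GL (Fin d) ℂ) (l : Fin d → ℂ) (q : Polynomial ℂ) :
    Polynomial.aeval (conjMat P (Matrix.diagonal l)) q =
      conjMat P (Matrix.diagonal (fun i => q.eval (l i))) := by
  rw [Polynomial.aeval_algHom_apply, aeval_diagonal]

/-- Prescribed values at distinct nodes are interpolated by a polynomial. -/
theorem exists_eval_eq {x : Fin d → ℂ} (hx : Function.Injective x) (y : Fin d → ℂ) :
    ∃ q : Polynomial ℂ, ∀ i, q.eval (x i) = y i :=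
  ⟨Lagrange.interpolate Finset.univ x y, fun i =>
    Lagrange.eval_interpolate_at_node y hx.injOn (Finset.mem_univ i)⟩

/-- Each `l i` is a root of the characteristic polynomial, hence an eigenvalue; eigenvectors for
distinct eigenvalues are independent, so they form the columns of the invertible matrix `Q`. -/
theorem exists_conjMat_diagonal_of_charpoly {B : Matrix (Fin d) (Fin d) ℂ} {l : Fin d → ℂ}
    (hl : Function.Injective l) (hB : B.charpoly = (Matrix.diagonal l).charpoly) :
    ∃ Q : GL (Fin d) ℂ, B = conjMat Q (Matrix.diagonal l) := by
  have hev : ∀ i, ∃ v : Fin d → ℂ, Module.End.HasEigenvector (Matrix.toLin' B) (l i) v := by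
    intro i
    refine Module.End.HasEigenvalue.exists_hasEigenvector ?_
    rw [Module.End.hasEigenvalue_iff_isRoot_charpoly, Matrix.charpoly_toLin', hB,
      Matrix.charpoly_diagonal, Polynomial.IsRoot, Polynomial.eval_prod]
    exact Finset.prod_eq_zero (Finset.mem_univ i) (by simp)
  choose v hv using hev
  have hli := Module.End.eigenvectors_linearIndependent' (Matrix.toLin' B) l hl v hv
  let M : Matrix (Fin d) (Fin d) ℂ := (Matrix.of v).transpose
  have hM : IsUnit M := by
    have h : LinearIndependent ℂ M.col := hli
    exact Matrix.linearIndependent_cols_iff_isUnit.1 h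
  refine ⟨hM.unit, ?_⟩
  have hBM : B * M = M * Matrix.diagonal l := by
    ext a b
    have h := congrFun (Module.End.HasEigenvector.apply_eq_smul (hv b)) a
    rw [Matrix.toLin'_apply] at h
    rw [Matrix.mul_diagonal, Matrix.mul_apply]
    simpa [Matrix.mulVec, dotProduct, M, mul_comm] using h
  have hu : (hM.unit : Matrix (Fin d) (Fin d) ℂ) = M := rfl
  rw [conjMat_apply, hu, ← hBM, Matrix.mul_assoc]
  have hinv : M * ((hM.unit⁻¹ : GL (Fin d) ℂ) : Matrix (Fin d) (Fin d) ℂ) = 1 :=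
    hM.mul_val_inv
  rw [hinv, Matrix.mul_one]

theorem isEigenvalueList_conjMat_diagonal (P : GL (Fin d) ℂ) {l : Fin d → ℂ}
    (hl : StrictAnti (fun j => ‖l j‖)) :
    IsEigenvalueList (conjMat P (Matrix.diagonal l)) l := by
  refine ⟨hl.antitone, ?_⟩
  rw [charpoly_conjMat, Matrix.charpoly_diagonal]
  have h := Polynomial.roots_multiset_prod_X_sub_C (Finset.univ.val.map l)
  rw [Multiset.map_map] at h
  exact h.symm

/-- A matrix with eigenvalues of distinct moduli determines their list in decreasing order. -/
theorem eq_of_charpoly_conjMat_diagonal (P Q : GL (Fin d) ℂ) {l m : Fin d → ℂ}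
    (hl : StrictAnti (fun j => ‖l j‖)) (hm : StrictAnti (fun j => ‖m j‖))
    (h : (conjMat P (Matrix.diagonal l)).charpoly = (conjMat Q (Matrix.diagonal m)).charpoly) :
    l = m := by
  have h1 := isEigenvalueList_conjMat_diagonal P hl
  refine IsEigenvalueList.eq_of_diagonalization (A := conjMat Q (Matrix.diagonal m))
    ⟨h1.1, by rw [← h]; exact h1.2⟩ Q m hm rfl

theorem proj_eq_of_smul {A B : SLC d} {c : ℂ} (h : A.1 = c • B.1) : proj d A = proj d B := by
  refine (QuotientGroup.eq.2 ?_).symm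
  refine Matrix.SpecialLinearGroup.mem_center_iff.2 ⟨c, ?_, ?_⟩
  · have h1 := congrArg Matrix.det h
    rw [Matrix.det_smul, A.2, B.2, mul_one] at h1
    exact h1.symm
  · rw [Matrix.SpecialLinearGroup.coe_mul, h, Matrix.mul_smul,
      ← Matrix.SpecialLinearGroup.coe_mul, inv_mul_cancel, Matrix.SpecialLinearGroup.coe_one]
    ext a b
    simp [Matrix.smul_apply, Matrix.one_apply, Matrix.diagonal_apply]

theorem exists_smul_of_proj_eq {A B : SLC d} (h : proj d A = proj d B) :
    ∃ c : ℂ, c ^ d = 1 ∧ A.1 = c • B.1 := by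
  have hz : B⁻¹ * A ∈ Subgroup.center (SLC d) := QuotientGroup.eq.1 h.symm
  obtain ⟨c, hc, hcz⟩ := Matrix.SpecialLinearGroup.mem_center_iff.1 hz
  refine ⟨c, by simpa using hc, ?_⟩
  have h2 : A = B * (B⁻¹ * A) := by group
  rw [h2, Matrix.SpecialLinearGroup.coe_mul, ← hcz]
  ext a b
  simp [mul_comm]

theorem proj_surjective : Function.Surjective (proj d) := QuotientGroup.mk'_surjective _

/-- Every lift of an element with distinct moduli is diagonalizable, with the moduli of the
eigenvalues in decreasing order. -/
theorem HasDistinctModuli.exists_conjMat {A : SLC d} (h : HasDistinctModuli (proj d A)) :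
    ∃ (P : GL (Fin d) ℂ) (l : Fin d → ℂ), StrictAnti (fun j => ‖l j‖) ∧
      A.1 = conjMat P (Matrix.diagonal l) := by
  obtain ⟨B, hB, P, l, hl, hBP⟩ := h
  obtain ⟨c, hc, hAB⟩ := exists_smul_of_proj_eq hB.symm
  rcases Nat.eq_zero_or_pos d with rfl | hd
  · exact ⟨1, l, fun i => i.elim0, Subsingleton.elim _ _⟩
  have hc0 : c ≠ 0 := by
    rintro rfl
    rw [zero_pow hd.ne'] at hc
    exact zero_ne_one hc
  let s := Tuple.sort (fun j => -‖l j‖)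
  have hs : Antitone (fun j => ‖l (s j)‖) := fun i j hij => by
    have := Tuple.monotone_sort (fun j => -‖l j‖) hij
    simpa using this
  have hs' : StrictAnti (fun j => ‖c * l (s j)‖) := by
    simp only [norm_mul]
    exact (hs.strictAnti_of_injective (hl.comp s.injective)).const_mul (norm_pos_iff.2 hc0)
  have hA : A.1 = conjMat P (Matrix.diagonal fun j => c * l j) := by
    have h3 : Matrix.diagonal (fun j => c * l j) = c • Matrix.diagonal l := by
      ext a b
      by_cases h : a = b <;> simp [h]
    rw [h3, map_smul, conjMat_apply, ← hBP, hAB]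
  -- Sorting the eigenvalues does not change the characteristic polynomial, so diagonalizing afresh
  -- replaces permuting the columns of `P`.
  obtain ⟨Q, hQ⟩ := exists_conjMat_diagonal_of_charpoly (B := A.1)
    (l := fun j => c * l (s j)) (fun i j hij => hs'.injective (congrArg norm hij)) (by
      rw [hA, charpoly_conjMat, Matrix.charpoly_diagonal, Matrix.charpoly_diagonal]
      exact (Equiv.prod_comp s (fun j => Polynomial.X - Polynomial.C (c * l j))).symm)
  exact ⟨Q, _, hs', hQ⟩

theorem hasDistinctModuli_of_conjMat {A : SLC d} {P : GL (Fin d) ℂ} {l : Fin d → ℂ}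
    (hl : StrictAnti (fun j => ‖l j‖)) (hA : A.1 = conjMat P (Matrix.diagonal l)) :
    HasDistinctModuli (proj d A) :=
  ⟨A, rfl, P, l, hl.injective, hA⟩

/-- An invertible matrix can be rescaled into `SL(d, ℂ)`. -/
theorem exists_specialLinear_conjMat (P : GL (Fin d) ℂ) :
    ∃ M : SLC d, ∀ A : SLC d, (M * A * M⁻¹).1 = conjMat P A.1 := by
  rcases Nat.eq_zero_or_pos d with rfl | hd
  · exact ⟨1, fun A => Subsingleton.elim _ _⟩
  have hdet : (P : Matrix (Fin d) (Fin d) ℂ).det ≠ 0 :=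
    ((Matrix.isUnit_iff_isUnit_det _).1 P.isUnit).ne_zero
  -- A `d`-th root of `det P⁻¹`: then `c • P` has determinant one and induces the same conjugation.
  obtain ⟨c, hc⟩ := IsAlgClosed.exists_pow_nat_eq (P : Matrix (Fin d) (Fin d) ℂ).det⁻¹ hd
  have hc0 : c ≠ 0 := by
    rintro rfl
    rw [zero_pow hd.ne'] at hc
    exact inv_ne_zero hdet hc.symm
  let M : SLC d := ⟨c • (P : Matrix (Fin d) (Fin d) ℂ), by
    rw [Matrix.det_smul, Fintype.card_fin, hc, inv_mul_cancel₀ hdet]⟩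
  refine ⟨M, fun A => ?_⟩
  have hMinv : (M⁻¹).1 = c⁻¹ • ((P⁻¹ : GL (Fin d) ℂ) : Matrix (Fin d) (Fin d) ℂ) := by
    have h1 : (M⁻¹).1 * M.1 = 1 := by
      rw [← Matrix.SpecialLinearGroup.coe_mul, inv_mul_cancel, Matrix.SpecialLinearGroup.coe_one]
    have h2 : M.1 * (c⁻¹ • ((P⁻¹ : GL (Fin d) ℂ) : Matrix (Fin d) (Fin d) ℂ)) = 1 := by
      change (c • (P : Matrix (Fin d) (Fin d) ℂ)) * _ = 1
      rw [Matrix.smul_mul, Matrix.mul_smul, smul_smul, mul_inv_cancel₀ hc0, one_smul,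
        ← Units.val_mul, mul_inv_cancel, Units.val_one]
    exact left_inv_eq_right_inv h1 h2
  rw [Matrix.SpecialLinearGroup.coe_mul, Matrix.SpecialLinearGroup.coe_mul, conjMat_apply]
  change M.1 * A.1 * (M⁻¹).1 = _
  rw [hMinv]
  change (c • (P : Matrix (Fin d) (Fin d) ℂ)) * A.1 * _ = _
  rw [Matrix.smul_mul, Matrix.smul_mul, Matrix.mul_smul, smul_smul, mul_inv_cancel₀ hc0, one_smul]

end Diagonalization

/-! ### Matrix algebras containing the diagonal idempotents -/

section MatrixAlgebra

variable {d : ℕ}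

/-- Inserting a diagonal idempotent isolates one term of the matrix product, so matrix coefficients
can be multiplied along paths of indices without leaving the algebra. -/
theorem mul_single_mul_apply (r s : Matrix (Fin d) (Fin d) ℂ) (i j k : Fin d) :
    (r * (Matrix.single k k 1 : Matrix (Fin d) (Fin d) ℂ) * s) i j = r i k * s k j := by
  rw [Matrix.mul_apply, Finset.sum_eq_single k]
  · simp
  · intro b _ hb
    simp [hb]
  · simp

theorem trace_single_mul (r : Matrix (Fin d) (Fin d) ℂ) (j : Fin d) :
    (Matrix.single j j 1 * r).trace = r j j := by
  rw [Matrix.trace, Finset.sum_eq_single j]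
  · simp
  · intro b _ hb
    simp [hb]
  · simp

theorem single_mulVec_self (w : Fin d → ℂ) (j : Fin d) :
    Matrix.mulVec (Matrix.single j j 1) w = w j • Pi.single j 1 := by
  ext a
  rcases eq_or_ne a j with rfl | h
  · simp [Matrix.mulVec, dotProduct, Matrix.single_apply]
  · simp [Matrix.mulVec, dotProduct, h, h.symm]

/-- Two matrix representations of an algebra with equal traces, which contain the same diagonal
idempotents and whose matrix coefficients vanish symmetrically, are conjugate by a diagonal
matrix. -/
theorem exists_diagonal_intertwiner
    (R : Subalgebra ℂ (Matrix (Fin d) (Fin d) ℂ × Matrix (Fin d) (Fin d) ℂ))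
    (htr : ∀ r ∈ R, r.1.trace = r.2.trace)
    (hE : ∀ j, (Matrix.single j j 1, Matrix.single j j 1) ∈ R)
    (h₁ : ∀ j k, (∃ r ∈ R, r.1 j k ≠ 0) → ∃ r ∈ R, r.1 k j ≠ 0)
    (h₂ : ∀ j k, (∃ r ∈ R, r.2 j k ≠ 0) → ∃ r ∈ R, r.2 k j ≠ 0) :
    ∃ c : Fin d → ℂ, (∀ j, c j ≠ 0) ∧ ∀ r ∈ R, ∀ j k, r.2 j k * c k = c j * r.1 j k := by
  have hmul : ∀ r ∈ R, ∀ s ∈ R, ∀ k, ∃ u ∈ R, ∀ i j, u.1 i j = r.1 i k * s.1 k j ∧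
      u.2 i j = r.2 i k * s.2 k j := fun r hr s hs k =>
    ⟨_, mul_mem (mul_mem hr (hE k)) hs, fun i j =>
      ⟨mul_single_mul_apply _ _ _ _ _, mul_single_mul_apply _ _ _ _ _⟩⟩
  have hdiag : ∀ r ∈ R, ∀ j, r.1 j j = r.2 j j := by
    intro r hr j
    have h := htr _ (mul_mem (hE j) hr)
    rwa [Prod.fst_mul, Prod.snd_mul, trace_single_mul, trace_single_mul] at h
  -- Diagonal entries are traces of elements of `R`; applied to `r E_kk s`, this compares the loops
  -- `j → k → j` on the two sides.
  have hcyc : ∀ r ∈ R, ∀ s ∈ R, ∀ j k, r.1 j k * s.1 k j = r.2 j k * s.2 k j := by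
    intro r hr s hs j k
    obtain ⟨u, hu, h⟩ := hmul r hr s hs k
    rw [← (h j j).1, ← (h j j).2, hdiag u hu]
  have hz : ∀ r ∈ R, ∀ j k, r.1 j k = 0 ↔ r.2 j k = 0 := by
    intro r hr j k
    constructor
    · intro h
      by_contra hne
      obtain ⟨s, hs, hs0⟩ := h₂ j k ⟨r, hr, hne⟩
      have := hcyc r hr s hs j k
      rw [h, zero_mul] at this
      exact mul_ne_zero hne hs0 this.symm
    · intro h
      by_contra hne
      obtain ⟨s, hs, hs0⟩ := h₁ j k ⟨r, hr, hne⟩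
      have := hcyc r hr s hs j k
      rw [h, zero_mul] at this
      exact mul_ne_zero hne hs0 this
  -- The classes are the blocks of the first projection. Each class gets a base index `rep`, and `u
  -- j` is an element with nonzero coefficient from `j` to its base index.
  let S : Setoid (Fin d) :=
    { r := fun j k => ∃ r ∈ R, r.1 j k ≠ 0
      iseqv :=
        { refl := fun j => ⟨1, one_mem R, by simp⟩
          symm := fun {j k} h => h₁ j k h
          trans := by
            rintro i j k ⟨r, hr, hr0⟩ ⟨s, hs, hs0⟩
            obtain ⟨u, hu, h⟩ := hmul r hr s hs j
            exact ⟨u, hu, by rw [(h i k).1]; exact mul_ne_zero hr0 hs0⟩ } }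
  let rep : Fin d → Fin d := fun j => (Quotient.mk S j).out
  have hrep : ∀ j, ∃ r ∈ R, r.1 j (rep j) ≠ 0 := fun j =>
    h₁ _ _ (Quotient.exact (s := S) (Quotient.out_eq (Quotient.mk S j)))
  choose u hu hu0 using hrep
  have hu0' : ∀ j, (u j).2 j (rep j) ≠ 0 := fun j h => hu0 j ((hz _ (hu j) _ _).2 h)
  -- An intertwiner is determined in each block by its value at the base index; normalizing that
  -- scalar suggests this ratio of the two coefficients of `u j`.
  refine ⟨fun j => (u j).2 j (rep j) / (u j).1 j (rep j),
    fun j => div_ne_zero (hu0' j) (hu0 j), fun r hr j k => ?_⟩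
  by_cases h0 : r.1 j k = 0
  · rw [h0, (hz r hr j k).1 h0, zero_mul, mul_zero]
  have hjk : rep j = rep k := congrArg Quotient.out (Quotient.sound (s := S) ⟨r, hr, h0⟩)
  -- A return path from the base index to `j`. The desired relation follows by comparing the loops
  -- `j → rep j → j` and `j → k → rep j → j`, both of which have equal values on the two sides.
  obtain ⟨s, hs, hs0⟩ := h₁ _ _ ⟨u j, hu j, hu0 j⟩
  have hs0' : s.2 (rep j) j ≠ 0 := fun h => hs0 ((hz _ hs _ _).2 h)
  have e2 := hcyc _ (hu j) _ hs j (rep j)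
  obtain ⟨v, hv, hv'⟩ := hmul r hr _ (hu k) k
  have e3 := hcyc _ hv _ hs j (rep j)
  rw [(hv' _ _).1, (hv' _ _).2] at e3
  have hk := hu0 k
  have hk' := hu0' k
  have hj := hu0 j
  have hj' := hu0' j
  simp only
  rw [← hjk] at hk hk' ⊢
  generalize (u j).1 j (rep j) = a at *
  generalize (u j).2 j (rep j) = a' at *
  generalize (u k).1 k (rep j) = b at *
  generalize (u k).2 k (rep j) = b' at *
  generalize s.1 (rep j) j = t at *
  generalize s.2 (rep j) j = t' at *
  generalize r.1 j k = x at *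
  generalize r.2 j k = x' at *
  have ht : t = a' * t' / a := by field_simp; linear_combination e2
  subst ht
  field_simp at e3 ⊢
  linear_combination -e3

/-- The `(i, j)` matrix coefficient does not vanish identically on `R`. -/
def Reach (R : Subalgebra ℂ (Matrix (Fin d) (Fin d) ℂ)) (i j : Fin d) : Prop :=
  ∃ r ∈ R, r i j ≠ 0

theorem Reach.refl (R : Subalgebra ℂ (Matrix (Fin d) (Fin d) ℂ)) (i : Fin d) : Reach R i i :=
  ⟨1, one_mem R, by simp⟩

theorem Reach.trans {R : Subalgebra ℂ (Matrix (Fin d) (Fin d) ℂ)}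
    (hE : ∀ j, Matrix.single j j 1 ∈ R) {i j k : Fin d} (h : Reach R i j) (h' : Reach R j k) :
    Reach R i k := by
  obtain ⟨r, hr, hr0⟩ := h
  obtain ⟨s, hs, hs0⟩ := h'
  exact ⟨_, mul_mem (mul_mem hr (hE j)) hs, by
    rw [mul_single_mul_apply]; exact mul_ne_zero hr0 hs0⟩

/-- The coordinate subspace on a set of indices. -/
def coordSubspace (J : Set (Fin d)) : Submodule ℂ (Fin d → ℂ) where
  carrier := {w | ∀ i, i ∉ J → w i = 0}
  add_mem' := fun ha hb i hi => by rw [Pi.add_apply, ha i hi, hb i hi, add_zero]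
  zero_mem' := fun _ _ => rfl
  smul_mem' := fun c w hw i hi => by rw [Pi.smul_apply, hw i hi, smul_zero]

theorem isCompl_coordSubspace (J : Set (Fin d)) :
    IsCompl (coordSubspace J) (coordSubspace Jᶜ) := by
  classical
  constructor
  · rw [Submodule.disjoint_def]
    intro w hw hw'
    funext i
    by_cases hi : i ∈ J
    · exact hw' i (fun h => h hi)
    · exact hw i hi
  · rw [codisjoint_iff, Submodule.eq_top_iff']
    intro w
    refine Submodule.mem_sup.2 ⟨fun i => if i ∈ J then w i else 0, fun i hi => if_neg hi,
      fun i => if i ∈ J then 0 else w i, fun i hi => if_pos (not_not.1 hi), ?_⟩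
    funext i
    by_cases hi : i ∈ J <;> simp [hi]

theorem mulVec_mem_coordSubspace {J : Set (Fin d)} {r : Matrix (Fin d) (Fin d) ℂ}
    (h : ∀ i j, r i j ≠ 0 → j ∈ J → i ∈ J) {w : Fin d → ℂ} (hw : w ∈ coordSubspace J) :
    r.mulVec w ∈ coordSubspace J := by
  intro i hi
  change ∑ j, r i j * w j = 0
  refine Finset.sum_eq_zero fun j _ => ?_
  by_cases hj : j ∈ J
  · have : r i j = 0 := by
      by_contra hne
      exact hi (h i j hne hj)
    simp [this]
  · simp [hw j hj]

/-- A subspace stable under the diagonal idempotents is a coordinate subspace. -/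
theorem eq_coordSubspace {W : Submodule ℂ (Fin d → ℂ)}
    (hW : ∀ j, ∀ w ∈ W, Matrix.mulVec (Matrix.single j j 1) w ∈ W) :
    W = coordSubspace {j | (Pi.single j 1 : Fin d → ℂ) ∈ W} := by
  apply le_antisymm
  · intro w hw i hi
    by_contra hne
    have h := hW i w hw
    rw [single_mulVec_self] at h
    exact hi ((W.smul_mem_iff hne).1 h)
  · intro w hw
    have hsum : ∑ i, (Pi.single i (w i) : Fin d → ℂ) = w := Finset.univ_sum_single w
    rw [← hsum]
    refine sum_mem fun i _ => ?_
    by_cases hi : (Pi.single i 1 : Fin d → ℂ) ∈ W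
    · have : Pi.single i (w i) = w i • (Pi.single i 1 : Fin d → ℂ) := by
        rw [← Pi.single_smul, smul_eq_mul, mul_one]
      rw [this]
      exact W.smul_mem _ hi
    · rw [hw i hi, Pi.single_zero]
      exact zero_mem W

/-- The indices reaching `k` span an invariant subspace. If `j` is not among them, `e_j` must lie in
the invariant complement, which is again a coordinate subspace; moving along `k ← j` puts `e_k` in
the complement too, although it belongs to the original subspace. -/
theorem Reach.symm {R : Subalgebra ℂ (Matrix (Fin d) (Fin d) ℂ)}
    (hE : ∀ j, Matrix.single j j 1 ∈ R)
    (hcompl : ∀ W : Submodule ℂ (Fin d → ℂ), (∀ r ∈ R, ∀ w ∈ W, r.mulVec w ∈ W) →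
      ∃ W' : Submodule ℂ (Fin d → ℂ), (∀ r ∈ R, ∀ w ∈ W', r.mulVec w ∈ W') ∧ IsCompl W W')
    {k j : Fin d} (h : Reach R k j) : Reach R j k := by
  by_contra hjk
  obtain ⟨W', hW', hc⟩ := hcompl (coordSubspace {i | Reach R i k}) fun r hr w hw =>
    mulVec_mem_coordSubspace (fun a b hab hb => Reach.trans hE ⟨r, hr, hab⟩ hb) hw
  have hW'c := eq_coordSubspace fun j w hw => hW' _ (hE j) w hw
  have hj : Pi.single j 1 ∈ W' := by
    have htop : Pi.single j 1 ∈ coordSubspace {i | Reach R i k} ⊔ W' := by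
      rw [hc.sup_eq_top]
      trivial
    obtain ⟨w, hw, w', hw', e⟩ := Submodule.mem_sup.1 htop
    by_contra hnot
    have h1 := hw j hjk
    rw [hW'c] at hw'
    have h2 := hw' j hnot
    have h3 := congrFun e j
    rw [Pi.add_apply, h1, h2] at h3
    simp at h3
  obtain ⟨r, hr, hr0⟩ := h
  have hk : Pi.single k 1 ∈ W' := by
    have h4 := hW' _ hr _ hj
    rw [hW'c] at h4
    by_contra hnot
    have := h4 k hnot
    simp [hr0] at this
  have hk' : (Pi.single k 1 : Fin d → ℂ) ∈ coordSubspace {i | Reach R i k} := by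
    intro i hi
    rw [Pi.single_eq_of_ne]
    rintro rfl
    exact hi (Reach.refl R i)
  have := (Submodule.disjoint_def.1 hc.disjoint) _ hk' hk
  have := congrFun this k
  simp at this

/-- Polynomials in a diagonal matrix with distinct entries give the diagonal idempotents. -/
theorem exists_aeval_diagonal_eq_single {l : Fin d → ℂ} (hl : Function.Injective l) (j : Fin d) :
    ∃ q : Polynomial ℂ, Polynomial.aeval (Matrix.diagonal l) q = Matrix.single j j 1 := by
  obtain ⟨q, hq⟩ := exists_eval_eq hl (Pi.single j 1)
  refine ⟨q, ?_⟩
  rw [aeval_diagonal, ← Matrix.diagonal_single]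
  simp only [hq]

theorem aeval_mem_subalgebra {𝒜 : Type*} [Ring 𝒜] [Algebra ℂ 𝒜] {R : Subalgebra ℂ 𝒜} {x : 𝒜}
    (hx : x ∈ R) (q : Polynomial ℂ) : Polynomial.aeval x q ∈ R := by
  have h := Polynomial.aeval_algHom_apply R.val ⟨x, hx⟩ q
  rw [Subalgebra.coe_val] at h
  rw [h]
  exact SetLike.coe_mem _

theorem stable_adjoin {s : Set (Matrix (Fin d) (Fin d) ℂ)} {W : Submodule ℂ (Fin d → ℂ)}
    (h : ∀ r ∈ s, ∀ w ∈ W, r.mulVec w ∈ W) :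
    ∀ r ∈ Algebra.adjoin ℂ s, ∀ w ∈ W, r.mulVec w ∈ W := by
  intro r hr
  induction hr using Algebra.adjoin_induction with
  | mem x hx => exact h x hx
  | algebraMap c =>
    intro w hw
    rw [Algebra.algebraMap_eq_smul_one, Matrix.smul_mulVec, Matrix.one_mulVec]
    exact W.smul_mem c hw
  | add x y _ _ hx hy =>
    intro w hw
    rw [Matrix.add_mulVec]
    exact W.add_mem (hx w hw) (hy w hw)
  | mul x y _ _ hx hy =>
    intro w hw
    rw [← Matrix.mulVec_mulVec]
    exact hx _ (hy w hw)

end MatrixAlgebra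

/-! ### Groups with a Noetherian topology -/

section Noetherian

open TopologicalSpace

/-- Multiplication is only separately continuous here. Irreducibility of `Y` puts each `x * Y`
inside one of the two closed sets; the `x` for which it is a given one form a closed set, so
irreducibility of `X` makes the choice uniform. -/
theorem isIrreducible_mul {G : Type*} [Group G] [TopologicalSpace G]
    (hl : ∀ g : G, Continuous (fun x => g * x)) (hr : ∀ g : G, Continuous (fun x => x * g))
    {X Y : Set G} (hX : IsIrreducible X) (hY : IsIrreducible Y) :
    IsIrreducible (Set.image2 (· * ·) X Y) := by
  refine ⟨Set.Nonempty.image2 hX.1 hY.1, ?_⟩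
  rw [isPreirreducible_iff_isClosed_union_isClosed]
  intro Z₁ Z₂ h₁ h₂ hsub
  have key : ∀ Z : Set G, IsClosed Z → IsClosed {x | ∀ y ∈ Y, x * y ∈ Z} := by
    intro Z hZ
    have h : {x | ∀ y ∈ Y, x * y ∈ Z} = ⋂ y ∈ Y, (fun x => x * y) ⁻¹' Z := by
      ext x
      simp
    rw [h]
    exact isClosed_biInter fun y _ => hZ.preimage (hr y)
  have hcov : X ⊆ {x | ∀ y ∈ Y, x * y ∈ Z₁} ∪ {x | ∀ y ∈ Y, x * y ∈ Z₂} := by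
    intro x hx
    rcases isPreirreducible_iff_isClosed_union_isClosed.1 hY.2
      ((fun y => x * y) ⁻¹' Z₁) ((fun y => x * y) ⁻¹' Z₂) (h₁.preimage (hl x))
      (h₂.preimage (hl x)) (fun y hy => hsub ⟨x, hx, y, hy, rfl⟩) with h | h
    · exact Or.inl fun y hy => h hy
    · exact Or.inr fun y hy => h hy
  rcases isPreirreducible_iff_isClosed_union_isClosed.1 hX.2 _ _ (key Z₁ h₁) (key Z₂ h₂) hcov
    with h | h
  · left
    rintro _ ⟨x, hx, y, hy, rfl⟩
    exact h hx y hy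
  · right
    rintro _ ⟨x, hx, y, hy, rfl⟩
    exact h hx y hy

/-- In a group with a Noetherian topology and continuous translations, the irreducible component
of the identity is a subgroup containing a positive power of every element. -/
theorem exists_subgroup_isIrreducible {G : Type*} [Group G] [TopologicalSpace G]
    [NoetherianSpace G] (hl : ∀ g : G, Continuous (fun x => g * x))
    (hr : ∀ g : G, Continuous (fun x => x * g)) :
    ∃ H : Subgroup G, IsIrreducible (H : Set G) ∧ ∀ g : G, ∃ n : ℕ, 0 < n ∧ g ^ n ∈ H := by
  set X : Set G := irreducibleComponent 1 with hXdef
  have hX : IsIrreducible X := isIrreducible_irreducibleComponent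
  have h1 : (1 : G) ∈ X := mem_irreducibleComponent
  have hmax : ∀ Y : Set G, IsIrreducible Y → X ⊆ Y → Y = X := fun Y hY h =>
    eq_irreducibleComponent hY.2 h
  -- The product `X * Y` is irreducible and contains `X`, hence equals `X` by maximality; it also
  -- contains `Y`.
  have hmul : ∀ Y : Set G, IsIrreducible Y → (1 : G) ∈ Y → Y ⊆ X := by
    intro Y hY hY1
    have h := hmax _ (isIrreducible_mul hl hr hX hY) (fun x hx => ⟨x, hx, 1, hY1, mul_one x⟩)
    intro y hy
    rw [← h]
    exact ⟨1, h1, y, hy, one_mul y⟩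
  have htrans : ∀ (g : G) (Y : Set G), IsIrreducible Y → IsIrreducible ((fun x => g * x) '' Y) :=
    fun g Y hY => hY.image _ (hl g).continuousOn
  let H : Subgroup G :=
    { carrier := X
      one_mem' := h1
      mul_mem' := by
        intro a b ha hb
        exact hmul _ (isIrreducible_mul hl hr hX hX) ⟨1, h1, 1, h1, mul_one 1⟩ ⟨a, ha, b, hb, rfl⟩
      inv_mem' := by
        intro a ha
        exact hmul _ (htrans a⁻¹ X hX) ⟨a, ha, inv_mul_cancel a⟩ ⟨1, h1, mul_one _⟩ }
  refine ⟨H, hX, fun g => ?_⟩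
  -- The cosets of `X` are irreducible components. There are only finitely many, so two powers of
  -- `g` give the same coset.
  have hcomp : ∀ g : G, (fun x => g * x) '' X ∈ irreducibleComponents G := by
    intro g
    refine ⟨htrans g X hX, fun Y hY hle => ?_⟩
    have h : (fun x => g⁻¹ * x) '' Y = X := hmax _ (htrans g⁻¹ Y hY) fun x hx =>
      ⟨g * x, hle ⟨x, hx, rfl⟩, inv_mul_cancel_left g x⟩
    intro y hy
    exact ⟨g⁻¹ * y, h ▸ ⟨y, hy, rfl⟩, mul_inv_cancel_left g y⟩
  have hfin := NoetherianSpace.finite_irreducibleComponents (α := G)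
  have : ¬ Function.Injective (fun n : ℕ =>
      (⟨_, hcomp (g ^ n)⟩ : irreducibleComponents G)) := by
    intro hinj
    have := hfin.to_subtype
    exact not_injective_infinite_finite _ hinj
  simp only [Function.Injective, not_forall] at this
  obtain ⟨m, n, hmn, hne⟩ := this
  have hmn' : (fun x => g ^ m * x) '' X = (fun x => g ^ n * x) '' X := congrArg Subtype.val hmn
  have main : ∀ m n : ℕ, m < n → (fun x => g ^ m * x) '' X = (fun x => g ^ n * x) '' X →
      ∃ k : ℕ, 0 < k ∧ g ^ k ∈ H := by
    intro m n hlt h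
    refine ⟨n - m, Nat.sub_pos_of_lt hlt, ?_⟩
    have hx : g ^ n ∈ (fun x => g ^ m * x) '' X := h ▸ ⟨1, h1, mul_one _⟩
    obtain ⟨x, hx, hxe⟩ := hx
    have : g ^ (n - m) = x := by
      have h2 : g ^ m * g ^ (n - m) = g ^ n := by rw [← pow_add, Nat.add_sub_cancel' hlt.le]
      exact mul_left_cancel (h2.trans hxe.symm)
    rw [this]
    exact hx
  rcases lt_or_gt_of_ne hne with h | h
  · exact main m n h hmn'
  · exact main n m h hmn'.symm

end Noetherian

/-! ### Zariski topology -/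

section Zariski

open TopologicalSpace

/-- If finitely many algebraic subsets cover a group with polynomial translations, then one of them
contains a subgroup which contains a positive power of every element. -/
theorem exists_subgroup_subset_of_cover {G σ ι : Type*} [Group G] [Finite σ] [Finite ι]
    (φ : G → σ → ℂ)
    (hl : ∀ g s, ∃ p : MvPolynomial σ ℂ, ∀ x, φ (g * x) s = MvPolynomial.eval (φ x) p)
    (hr : ∀ g s, ∃ p : MvPolynomial σ ℂ, ∀ x, φ (x * g) s = MvPolynomial.eval (φ x) p)
    (Z : ι → Set G)
    (hZ : ∀ i, ∃ P : Set (MvPolynomial σ ℂ), Z i = {x | ∀ p ∈ P, MvPolynomial.eval (φ x) p = 0})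
    (hcov : ∀ x, ∃ i, x ∈ Z i) :
    ∃ (H : Subgroup G) (i : ι), (∀ x ∈ H, x ∈ Z i) ∧ ∀ g : G, ∃ n : ℕ, 0 < n ∧ g ^ n ∈ H := by
  -- Sending a point to its ideal of vanishing polynomials induces the Zariski topology on `G`,
  -- which is Noetherian because the polynomial ring is.
  let pt : G → PrimeSpectrum (MvPolynomial σ ℂ) := fun x =>
    ⟨RingHom.ker (MvPolynomial.eval (φ x)), RingHom.ker_isPrime _⟩
  let : TopologicalSpace G := TopologicalSpace.induced pt inferInstance
  have hpt : Topology.IsInducing pt := ⟨rfl⟩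
  have : NoetherianSpace G := hpt.noetherianSpace
  have key : ∀ f : G → G, (∀ s, ∃ p : MvPolynomial σ ℂ, ∀ x,
      φ (f x) s = MvPolynomial.eval (φ x) p) → Continuous f := by
    intro f hf
    choose F hF using hf
    rw [hpt.continuous_iff]
    have h : pt ∘ f = PrimeSpectrum.comap (MvPolynomial.aeval F).toRingHom ∘ pt := by
      funext x
      apply PrimeSpectrum.ext
      ext p
      change MvPolynomial.eval (φ (f x)) p = 0 ↔
        MvPolynomial.eval (φ x) (MvPolynomial.aeval F p) = 0
      have h2 : MvPolynomial.eval (φ x) (MvPolynomial.aeval F p) =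
          MvPolynomial.eval (φ (f x)) p := by
        have h3 : φ (f x) = fun s => MvPolynomial.eval (φ x) (F s) := funext fun s => hF s x
        rw [h3, MvPolynomial.aeval_def, MvPolynomial.algebraMap_eq]
        exact (MvPolynomial.eval_eval₂ ..).trans (by
          rw [← MvPolynomial.eval₂_id]
          congr 1
          ext c
          simp)
      rw [h2]
    rw [h]
    exact (PrimeSpectrum.continuous_comap _).comp continuous_induced_dom
  obtain ⟨H, hH, hpow⟩ := exists_subgroup_isIrreducible (G := G)
    (fun g => key _ (hl g)) (fun g => key _ (hr g))
  have hclosed : ∀ i, IsClosed (Z i) := by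
    intro i
    obtain ⟨P, hP⟩ := hZ i
    have h : Z i = pt ⁻¹' PrimeSpectrum.zeroLocus P := by
      rw [hP]
      ext x
      rfl
    rw [h]
    exact (PrimeSpectrum.isClosed_zeroLocus P).preimage continuous_induced_dom
  obtain ⟨Y, hY, hHY⟩ := isIrreducible_iff_sUnion_isClosed.1 hH (Set.finite_range Z).toFinset
    (fun z hz => by
      obtain ⟨i, rfl⟩ := (Set.Finite.mem_toFinset _).1 hz
      exact hclosed i)
    (fun x _ => by
      obtain ⟨i, hi⟩ := hcov x
      exact Set.mem_sUnion.2 ⟨Z i, by simp, hi⟩)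
  obtain ⟨i, rfl⟩ := (Set.Finite.mem_toFinset _).1 hY
  exact ⟨H, i, hHY, hpow⟩

end Zariski

/-! ### Semisimplification -/

section Truncation

variable {d : ℕ} {R : Subalgebra ℂ (Matrix (Fin d) (Fin d) ℂ)}

open Classical in
/-- The block-diagonal part of a matrix, the blocks being the classes of mutually reachable
indices. -/
noncomputable def trunc (R : Subalgebra ℂ (Matrix (Fin d) (Fin d) ℂ))
    (A : Matrix (Fin d) (Fin d) ℂ) : Matrix (Fin d) (Fin d) ℂ :=
  Matrix.of fun i j => if Reach R i j ∧ Reach R j i then A i j else 0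

theorem trunc_of_reach {i j : Fin d} (h : Reach R i j ∧ Reach R j i)
    (A : Matrix (Fin d) (Fin d) ℂ) : trunc R A i j = A i j := if_pos h

theorem trunc_of_not_reach {i j : Fin d} (h : ¬(Reach R i j ∧ Reach R j i))
    (A : Matrix (Fin d) (Fin d) ℂ) : trunc R A i j = 0 := if_neg h

theorem trunc_add (A B : Matrix (Fin d) (Fin d) ℂ) :
    trunc R (A + B) = trunc R A + trunc R B := by
  ext i j
  by_cases h : Reach R i j ∧ Reach R j i
  · simp [trunc_of_reach h]
  · simp [trunc_of_not_reach h]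

theorem trunc_smul (c : ℂ) (A : Matrix (Fin d) (Fin d) ℂ) : trunc R (c • A) = c • trunc R A := by
  ext i j
  by_cases h : Reach R i j ∧ Reach R j i
  · simp [trunc_of_reach h]
  · simp [trunc_of_not_reach h]

theorem trunc_diagonal (l : Fin d → ℂ) : trunc R (Matrix.diagonal l) = Matrix.diagonal l := by
  ext i j
  by_cases h : Reach R i j ∧ Reach R j i
  · rw [trunc_of_reach h]
  · rw [trunc_of_not_reach h, Matrix.diagonal_apply_ne]
    rintro rfl
    exact h ⟨Reach.refl R i, Reach.refl R i⟩

theorem trunc_one : trunc R 1 = 1 := by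
  rw [← Matrix.diagonal_one, trunc_diagonal]

/-- A nonzero term `A i k * B k j` with `i`, `j` in one block gives the cycle `i → k → j → i`, so
`k` lies in that block as well. -/
theorem trunc_mul (hE : ∀ j, Matrix.single j j 1 ∈ R) {A B : Matrix (Fin d) (Fin d) ℂ}
    (hA : A ∈ R) (hB : B ∈ R) : trunc R (A * B) = trunc R A * trunc R B := by
  ext i j
  rw [Matrix.mul_apply]
  by_cases h : Reach R i j ∧ Reach R j i
  · rw [trunc_of_reach h, Matrix.mul_apply]
    refine Finset.sum_congr rfl fun k _ => ?_
    by_cases hik : A i k = 0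
    · have : trunc R A i k = 0 := by
        by_cases h' : Reach R i k ∧ Reach R k i
        · rw [trunc_of_reach h', hik]
        · rw [trunc_of_not_reach h']
      rw [hik, this, zero_mul, zero_mul]
    by_cases hkj : B k j = 0
    · have : trunc R B k j = 0 := by
        by_cases h' : Reach R k j ∧ Reach R j k
        · rw [trunc_of_reach h', hkj]
        · rw [trunc_of_not_reach h']
      rw [hkj, this, mul_zero, mul_zero]
    have h1 : Reach R i k := ⟨A, hA, hik⟩
    have h2 : Reach R k j := ⟨B, hB, hkj⟩
    rw [trunc_of_reach ⟨h1, h2.trans hE h.2⟩, trunc_of_reach ⟨h2, h.2.trans hE h1⟩]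
  · rw [trunc_of_not_reach h]
    refine (Finset.sum_eq_zero fun k _ => ?_).symm
    by_cases h1 : Reach R i k ∧ Reach R k i
    · by_cases h2 : Reach R k j ∧ Reach R j k
      · exact absurd ⟨h1.1.trans hE h2.1, h2.2.trans hE h1.2⟩ h
      · rw [trunc_of_not_reach h2, mul_zero]
    · rw [trunc_of_not_reach h1, zero_mul]

/-- The diagonal matrix with the entries `2 ^ (-n h)`. -/
noncomputable def dyadicDiagonal (h : Fin d → ℕ) (n : ℕ) : GL (Fin d) ℂ where
  val := Matrix.diagonal fun i => (1 / 2 : ℂ) ^ (n * h i)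
  inv := Matrix.diagonal fun i => (2 : ℂ) ^ (n * h i)
  val_inv := by
    rw [Matrix.diagonal_mul_diagonal, ← Matrix.diagonal_one]
    congr 1
    funext i
    rw [← mul_pow]
    norm_num
  inv_val := by
    rw [Matrix.diagonal_mul_diagonal, ← Matrix.diagonal_one]
    congr 1
    funext i
    rw [← mul_pow]
    norm_num

theorem conjMat_dyadicDiagonal (h : Fin d → ℕ) (n : ℕ) (A : Matrix (Fin d) (Fin d) ℂ)
    (i j : Fin d) : conjMat (dyadicDiagonal h n) A i j =
      (1 / 2 : ℂ) ^ (n * h i) * A i j * (2 : ℂ) ^ (n * h j) := by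
  change (Matrix.diagonal (fun i => (1 / 2 : ℂ) ^ (n * h i)) * A *
    Matrix.diagonal (fun i => (2 : ℂ) ^ (n * h i))) i j = _
  rw [Matrix.mul_diagonal, Matrix.diagonal_mul]

-- Weight each index by the number of indices it reaches. A nonzero entry `(i, j)` of an element of
-- `R` goes from higher or equal weight to lower, with equality exactly inside a block. Conjugation
-- by powers of two with these weights fixes the block entries and shrinks the others geometrically.
open Classical Filter Topology in
theorem exists_tendsto_trunc (hE : ∀ j, Matrix.single j j 1 ∈ R) :
    ∃ D : ℕ → GL (Fin d) ℂ, ∀ A ∈ R,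
      Tendsto (fun n => conjMat (D n) A) atTop (𝓝 (trunc R A)) := by
  let h : Fin d → ℕ := fun i => (Finset.univ.filter fun k => Reach R i k).card
  refine ⟨dyadicDiagonal h, fun A hA => ?_⟩
  refine tendsto_pi_nhds.2 fun i => tendsto_pi_nhds.2 fun j => ?_
  simp only [conjMat_dyadicDiagonal]
  by_cases hA0 : A i j = 0
  · have : trunc R A i j = 0 := by
      by_cases h' : Reach R i j ∧ Reach R j i
      · rw [trunc_of_reach h', hA0]
      · rw [trunc_of_not_reach h']
    rw [this, hA0]
    simp
  have hij : Reach R i j := ⟨A, hA, hA0⟩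
  have hsub : (Finset.univ.filter fun k => Reach R j k) ⊆
      (Finset.univ.filter fun k => Reach R i k) := fun k hk =>
    Finset.mem_filter.2 ⟨Finset.mem_univ k, hij.trans hE (Finset.mem_filter.1 hk).2⟩
  have hle : h j ≤ h i := Finset.card_le_card hsub
  have hpow : ∀ n : ℕ, (1 / 2 : ℂ) ^ (n * h i) * A i j * (2 : ℂ) ^ (n * h j) =
      A i j * ((1 / 2 : ℂ) ^ (h i - h j)) ^ n := by
    intro n
    have : n * h i = n * h j + (h i - h j) * n := by
      obtain ⟨m, hm⟩ := Nat.exists_eq_add_of_le hle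
      rw [hm, Nat.add_sub_cancel_left]
      ring
    rw [this, pow_add, pow_mul _ (h i - h j)]
    have h1 : (1 / 2 : ℂ) ^ (n * h j) * 2 ^ (n * h j) = 1 := by
      rw [← mul_pow]
      norm_num
    linear_combination (A i j * ((1 / 2 : ℂ) ^ (h i - h j)) ^ n) * h1
  simp only [hpow]
  by_cases hji : Reach R j i
  · have heq : h i = h j := by
      refine le_antisymm (Finset.card_le_card fun k hk => ?_) hle
      exact Finset.mem_filter.2 ⟨Finset.mem_univ k, hji.trans hE (Finset.mem_filter.1 hk).2⟩
    rw [trunc_of_reach ⟨hij, hji⟩, heq]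
    simp
  · have hlt : h j < h i := by
      refine Finset.card_lt_card (Finset.ssubset_iff_subset_ne.2 ⟨hsub, fun he => hji ?_⟩)
      have : i ∈ Finset.univ.filter fun k => Reach R i k :=
        Finset.mem_filter.2 ⟨Finset.mem_univ i, Reach.refl R i⟩
      rw [← he] at this
      exact (Finset.mem_filter.1 this).2
    rw [trunc_of_not_reach fun h' => hji h'.2]
    rw [← mul_zero (A i j)]
    refine tendsto_const_nhds.mul (tendsto_pow_atTop_nhds_zero_of_norm_lt_one ?_)
    rw [norm_pow]
    refine pow_lt_one₀ (norm_nonneg _) (by norm_num) (Nat.sub_pos_of_lt hlt).ne'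

/-- The truncation is a limit of conjugates of `A`, along which `f` is constant. -/
theorem eq_trunc_of_continuous (hE : ∀ j, Matrix.single j j 1 ∈ R)
    {f : Matrix (Fin d) (Fin d) ℂ → ℂ} (hf : Continuous f)
    (hinv : ∀ P A, f (conjMat P A) = f A) {A : Matrix (Fin d) (Fin d) ℂ} (hA : A ∈ R) :
    f (trunc R A) = f A := by
  obtain ⟨D, hD⟩ := exists_tendsto_trunc hE
  have h := (hf.tendsto _).comp (hD A hA)
  simp only [Function.comp_def, hinv] at h
  exact tendsto_nhds_unique h tendsto_const_nhds

theorem det_trunc (hE : ∀ j, Matrix.single j j 1 ∈ R) {A : Matrix (Fin d) (Fin d) ℂ}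
    (hA : A ∈ R) : (trunc R A).det = A.det :=
  eq_trunc_of_continuous hE (continuous_id.matrix_det) det_conjMat hA

theorem charpoly_trunc (hE : ∀ j, Matrix.single j j 1 ∈ R) {A : Matrix (Fin d) (Fin d) ℂ}
    (hA : A ∈ R) : (trunc R A).charpoly = A.charpoly := by
  refine Polynomial.funext fun x => ?_
  refine eq_trunc_of_continuous (f := fun A => A.charpoly.eval x) hE ?_
    (fun P A => by rw [charpoly_conjMat]) hA
  simp only [Matrix.eval_charpoly]
  exact (continuous_const.sub continuous_id).matrix_det

end Truncation

/-! ### Degeneration of representations to completely reducible ones -/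

section Semisimplification

open Filter Topology

variable {Γ : Type*} [Group Γ] {d : ℕ}

theorem tendsto_regularFunctions {ρs : ℕ → Γ →* PSLC d} {σ : Γ →* PSLC d}
    (h : ∀ γ, ∃ (A : ℕ → SLC d) (B : SLC d), (∀ n, proj d (A n) = ρs n γ) ∧ proj d B = σ γ ∧
      Tendsto (fun n => (A n).1) atTop (𝓝 B.1))
    {F : (Γ →* PSLC d) → ℂ} (hF : F ∈ regularFunctions Γ d) :
    Tendsto (fun n => F (ρs n)) atTop (𝓝 (F σ)) := by
  induction hF using Algebra.adjoin_induction with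
  | mem F hF =>
    obtain ⟨γ, f, ⟨p, hp⟩, rfl⟩ := hF
    obtain ⟨A, B, hA, hB, hlim⟩ := h γ
    simp only [← hA, ← hB, hp]
    have hc : Continuous fun M : Matrix (Fin d) (Fin d) ℂ =>
        MvPolynomial.eval (fun ij : Fin d × Fin d => M ij.1 ij.2) p :=
      (MvPolynomial.continuous_eval p).comp
        (continuous_pi fun ij => continuous_id.matrix_elem ij.1 ij.2)
    exact (hc.tendsto _).comp hlim
  | algebraMap c => exact tendsto_const_nhds
  | add F G _ _ hF hG => exact hF.add hG
  | mul F G _ _ hF hG => exact hF.mul hG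

/-- A representation with an element of distinct moduli degenerates, by conjugation, to a completely
reducible representation with the same characteristic polynomials. -/
theorem exists_semisimplification (ρ : Γ →* PSLC d) {γ₀ : Γ} (h₀ : HasDistinctModuli (ρ γ₀)) :
    ∃ σ : Γ →* PSLC d, IsCompletelyReducible σ ∧
      (∀ γ, ∃ A B : SLC d, proj d A = ρ γ ∧ proj d B = σ γ ∧ B.1.charpoly = A.1.charpoly) ∧
      ∀ F ∈ regularFunctions Γ d, (∀ (M : PSLC d) (τ : Γ →* PSLC d), F (conjRep M τ) = F τ) →
        F σ = F ρ := by
  obtain ⟨A₀, hA₀⟩ := proj_surjective (ρ γ₀)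
  rw [← hA₀] at h₀
  obtain ⟨P, l, hl, hAl⟩ := h₀.exists_conjMat
  let S : Set (Matrix (Fin d) (Fin d) ℂ) :=
    {B | ∃ (γ : Γ) (A : SLC d), proj d A = ρ γ ∧ B = conjMat P⁻¹ A.1}
  let R := Algebra.adjoin ℂ S
  have hR : ∀ (γ : Γ) (A : SLC d), proj d A = ρ γ → conjMat P⁻¹ A.1 ∈ R := fun γ A h =>
    Algebra.subset_adjoin ⟨γ, A, h, rfl⟩
  have hlR : Matrix.diagonal l ∈ R := by
    have h := hR γ₀ A₀ hA₀
    rwa [hAl, conjMat_inv_conjMat] at h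
  have hlinj : Function.Injective l := fun i j hij => hl.injective (congrArg norm hij)
  have hE : ∀ j, Matrix.single j j 1 ∈ R := by
    intro j
    obtain ⟨q, hq⟩ := exists_aeval_diagonal_eq_single hlinj j
    rw [← hq]
    exact aeval_mem_subalgebra hlR q
  choose a ha using fun γ => proj_surjective (ρ γ)
  -- Truncation is linear, so lifts differing by a scalar keep the same class in `PSL`;
  -- multiplicativity on `R` then makes `σ` a homomorphism.
  let T : ∀ A : SLC d, conjMat P⁻¹ A.1 ∈ R → SLC d := fun A hA =>
    ⟨trunc R (conjMat P⁻¹ A.1), by rw [det_trunc hE hA, det_conjMat, A.2]⟩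
  have hT : ∀ (A B : SLC d) hA hB, proj d A = proj d B → proj d (T A hA) = proj d (T B hB) := by
    intro A B hA hB h
    obtain ⟨c, -, hc⟩ := exists_smul_of_proj_eq h
    refine proj_eq_of_smul (c := c) ?_
    change trunc R (conjMat P⁻¹ A.1) = c • trunc R (conjMat P⁻¹ B.1)
    rw [hc, map_smul, trunc_smul]
  let σ : Γ →* PSLC d := MonoidHom.mk' (fun γ => proj d (T (a γ) (hR γ _ (ha γ)))) (by
    intro γ δ
    have hprod : proj d (a γ * a δ) = ρ (γ * δ) := by rw [map_mul, map_mul, ha, ha]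
    rw [hT (a (γ * δ)) (a γ * a δ) (hR _ _ (ha _)) (hR _ _ hprod) ((ha _).trans hprod.symm), ← map_mul]
    congr 1
    apply Subtype.ext
    change trunc R (conjMat P⁻¹ ((a γ).1 * (a δ).1)) =
      trunc R (conjMat P⁻¹ (a γ).1) * trunc R (conjMat P⁻¹ (a δ).1)
    rw [map_mul, trunc_mul hE (hR γ _ (ha γ)) (hR δ _ (ha δ))])
  have hσ : ∀ (γ : Γ) (A : SLC d) (h : proj d A = ρ γ), proj d (T A (hR γ A h)) = σ γ :=
    fun γ A h =>
    hT A (a γ) (hR γ A h) (hR γ _ (ha γ)) (h.trans (ha γ).symm)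
  refine ⟨σ, ?_, fun γ => ⟨a γ, _, ha γ, hσ γ _ (ha γ), ?_⟩, ?_⟩
  · intro W hW
    -- Invariance passes from the generators to the truncation of all of `R`. The idempotents then
    -- force `W` to be a coordinate subspace, and the symmetry of the blocks makes the complementary
    -- coordinates invariant.
    have hstab : ∀ r ∈ R, ∀ w ∈ W, (trunc R r).mulVec w ∈ W := by
      intro r hr
      induction hr using Algebra.adjoin_induction with
      | mem x hx =>
        obtain ⟨γ, A, hA, rfl⟩ := hx
        intro w hw
        exact hW γ _ (hσ γ A hA) hw
      | algebraMap c =>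
        intro w hw
        rw [Algebra.algebraMap_eq_smul_one, trunc_smul, trunc_one, Matrix.smul_mulVec,
          Matrix.one_mulVec]
        exact W.smul_mem c hw
      | add x y _ _ hx hy =>
        intro w hw
        rw [trunc_add, Matrix.add_mulVec]
        exact W.add_mem (hx w hw) (hy w hw)
      | mul x y hx' hy' hx hy =>
        intro w hw
        rw [trunc_mul hE hx' hy', ← Matrix.mulVec_mulVec]
        exact hx _ (hy w hw)
    have hWc := eq_coordSubspace (W := W) fun j w hw => by
      have h := hstab _ (hE j) w hw
      rwa [← Matrix.diagonal_single, trunc_diagonal, Matrix.diagonal_single] at h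
    set J : Set (Fin d) := {j | (Pi.single j 1 : Fin d → ℂ) ∈ W} with hJ
    refine ⟨coordSubspace Jᶜ, ?_, hWc ▸ isCompl_coordSubspace J⟩
    intro γ B hB w hw
    obtain ⟨c, -, hc⟩ := exists_smul_of_proj_eq (hB.trans (hσ γ _ (ha γ)).symm)
    rw [Submodule.mem_comap, Matrix.toLin'_apply, hc, Matrix.smul_mulVec]
    refine Submodule.smul_mem _ _ (mulVec_mem_coordSubspace (J := Jᶜ) (fun i j hij hj hi => hj ?_) hw)
    have hreach : Reach R i j ∧ Reach R j i := by
      by_contra hn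
      exact hij (trunc_of_not_reach hn _)
    obtain ⟨r, hr, hr0⟩ := hreach.2
    have hm := hstab r hr _ hi
    rw [hWc] at hm
    by_contra hjJ
    have h0 := hm j hjJ
    simp [trunc_of_reach hreach.symm, hr0] at h0
  · change (trunc R (conjMat P⁻¹ (a γ).1)).charpoly = _
    rw [charpoly_trunc hE (hR γ _ (ha γ)), charpoly_conjMat]
  · intro F hF hinv
    obtain ⟨D, hD⟩ := exists_tendsto_trunc hE
    -- Rescaled into `SL(d, ℂ)`, so that the degeneration runs through conjugates of `ρ` itself, on
    -- which `F` is constant.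
    choose M hM using fun n => exists_specialLinear_conjMat (D n * P⁻¹)
    have hlim := tendsto_regularFunctions (ρs := fun n => conjRep (proj d (M n)) ρ) (σ := σ)
      (fun γ => ⟨fun n => M n * a γ * (M n)⁻¹, _, fun n => by
        rw [map_mul, map_mul, map_inv, ha]
        rfl, hσ γ _ (ha γ), by
        simp only [hM, conjMat_mul]
        exact hD _ (hR γ _ (ha γ))⟩) hF
    simp only [hinv] at hlim
    exact tendsto_nhds_unique tendsto_const_nhds hlim |>.symm

theorem HasDistinctModuli.of_charpoly_eq {A B : SLC d} (hA : HasDistinctModuli (proj d A))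
    (h : B.1.charpoly = A.1.charpoly) : HasDistinctModuli (proj d B) ∧
      ∀ (j : ℕ) (hj : j + 1 < d), gap (proj d B) j hj = gap (proj d A) j hj := by
  obtain ⟨P, l, hl, hAl⟩ := hA.exists_conjMat
  obtain ⟨Q, hQ⟩ := exists_conjMat_diagonal_of_charpoly (B := B.1)
    (fun i j hij => hl.injective (congrArg norm hij)) (by rw [h, hAl, charpoly_conjMat])
  refine ⟨hasDistinctModuli_of_conjMat hl hQ, fun j hj => ?_⟩
  rw [gap_eq A P l hl hAl, gap_eq B Q l hl hQ]

end Semisimplification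

/-! ### Representations with equal eigenvalue gaps -/

section Ratio

variable {d : ℕ}

theorem ne_zero_of_conjMat_diagonal {A : SLC d} {P : GL (Fin d) ℂ} {l : Fin d → ℂ}
    (hA : A.1 = conjMat P (Matrix.diagonal l)) (j : Fin d) : l j ≠ 0 := by
  intro h
  have h1 := A.2
  rw [hA, det_conjMat, Matrix.det_diagonal, Finset.prod_eq_zero (Finset.mem_univ j) h] at h1
  exact zero_ne_one h1

/-- Elements with the same gaps have lifts with the same eigenvalues, up to a common root of
unity. -/
theorem exists_common_eigenvalues (hd : 0 < d) {A A' : SLC d}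
    (hA : HasDistinctModuli (proj d A)) (hA' : HasDistinctModuli (proj d A'))
    (hgap : ∀ (j : ℕ) (hj : j + 1 < d), gap (proj d A) j hj = gap (proj d A') j hj) :
    ∃ (P Q : GL (Fin d) ℂ) (l : Fin d → ℂ) (ζ : ℂ), ζ ^ d = 1 ∧ StrictAnti (fun j => ‖l j‖) ∧
      A.1 = conjMat P (Matrix.diagonal fun j => ζ * l j) ∧ A'.1 = conjMat Q (Matrix.diagonal l) := by
  obtain ⟨P, m, hm, hAm⟩ := hA.exists_conjMat
  obtain ⟨Q, l, hl, hAl⟩ := hA'.exists_conjMat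
  have hm0 := ne_zero_of_conjMat_diagonal hAm
  have hl0 := ne_zero_of_conjMat_diagonal hAl
  -- The gaps telescope: every eigenvalue is determined by the first. The determinants then show
  -- that the ratio of the first eigenvalues is a `d`-th root of unity.
  have hml : ∀ (j : ℕ) (hj : j < d), m ⟨j, hj⟩ = m ⟨0, hd⟩ / l ⟨0, hd⟩ * l ⟨j, hj⟩ := by
    intro j
    induction j with
    | zero => exact fun _ => (div_mul_cancel₀ _ (hl0 _)).symm
    | succ j ih =>
      intro hj
      have h := hgap j hj
      rw [gap_eq A P m hm hAm, gap_eq A' Q l hl hAl,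
        div_eq_div_iff (hm0 _) (hl0 _), ih (Nat.lt_of_succ_lt hj)] at h
      have h2 : l ⟨j, Nat.lt_of_succ_lt hj⟩ * m ⟨j + 1, hj⟩ =
          l ⟨j, Nat.lt_of_succ_lt hj⟩ * (m ⟨0, hd⟩ / l ⟨0, hd⟩ * l ⟨j + 1, hj⟩) := by
        rw [← h]
        ring
      exact mul_left_cancel₀ (hl0 _) h2
  have hml' : m = fun j => m ⟨0, hd⟩ / l ⟨0, hd⟩ * l j := funext fun j => hml j.1 j.2
  refine ⟨P, Q, l, m ⟨0, hd⟩ / l ⟨0, hd⟩, ?_, hl, hml' ▸ hAm, hAl⟩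
  have h1 := A.2
  have h2 := A'.2
  rw [hAm, det_conjMat, Matrix.det_diagonal, hml', Finset.prod_mul_distrib, Finset.prod_const,
    Finset.card_univ, Fintype.card_fin] at h1
  rw [hAl, det_conjMat, Matrix.det_diagonal] at h2
  rwa [h2, mul_one] at h1

theorem strictAnti_norm_pow {l : Fin d → ℂ} (hl : StrictAnti (fun j => ‖l j‖)) {n : ℕ}
    (hn : 0 < n) : StrictAnti (fun j => ‖l j ^ n‖) := by
  intro i j hij
  simp only [norm_pow]
  exact pow_lt_pow_left₀ (hl hij) (norm_nonneg _) hn.ne'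

theorem conjMat_diagonal_pow (P : GL (Fin d) ℂ) (l : Fin d → ℂ) (n : ℕ) :
    conjMat P (Matrix.diagonal l) ^ n = conjMat P (Matrix.diagonal fun j => l j ^ n) := by
  rw [← map_pow, Matrix.diagonal_pow]
  rfl

/-- Taking `n`-th roots of eigenvalues is a polynomial operation. -/
theorem exists_aeval_pow {l : Fin d → ℂ} (hl : StrictAnti (fun j => ‖l j‖)) {n : ℕ} (hn : 0 < n) :
    ∃ q : Polynomial ℂ, ∀ P : GL (Fin d) ℂ,
      Polynomial.aeval (conjMat P (Matrix.diagonal fun j => l j ^ n)) q =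
        conjMat P (Matrix.diagonal l) := by
  -- The nodes are distinct because their moduli are. The polynomial depends on the eigenvalues
  -- alone, so it serves both representations at once.
  obtain ⟨q, hq⟩ := exists_eval_eq (x := fun j => l j ^ n)
    (fun i j hij => (strictAnti_norm_pow hl hn).injective (congrArg norm hij)) l
  exact ⟨q, fun P => by simp only [aeval_conjMat_diagonal, hq]⟩

theorem charpoly_eq_iff_forall_det {A B : Matrix (Fin d) (Fin d) ℂ} :
    A.charpoly = B.charpoly ↔
      ∀ x : ℂ, (Matrix.scalar (Fin d) x - A).det = (Matrix.scalar (Fin d) x - B).det := by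
  simp only [← Matrix.eval_charpoly]
  exact ⟨fun h x => by rw [h], Polynomial.funext⟩

theorem eval_det_scalar_sub {σ : Type*} (v : σ → ℂ) (t c : ℂ)
    (Y : Matrix (Fin d) (Fin d) (MvPolynomial σ ℂ)) :
    MvPolynomial.eval v (Matrix.scalar (Fin d) (MvPolynomial.C t) -
      (MvPolynomial.C c : MvPolynomial σ ℂ) • Y).det =
    (Matrix.scalar (Fin d) t - c • (MvPolynomial.eval v).mapMatrix Y).det := by
  rw [RingHom.map_det]
  congr 1
  ext i j
  by_cases h : i = j <;> simp [h]

/-- If the elements of a group of pairs of matrices have characteristic polynomials which agree up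
to roots of unity, then these agree on a subgroup containing a power of every element. -/
theorem exists_subgroup_charpoly_eq (hd : 0 < d) (K : Subgroup (SLC d × SLC d))
    (hK : ∀ x ∈ K, ∃ ζ : ℂ, ζ ^ d = 1 ∧ x.1.1.charpoly = (ζ • x.2.1).charpoly) :
    ∃ H : Subgroup (SLC d × SLC d), H ≤ K ∧ (∀ x ∈ H, x.1.1.charpoly = x.2.1.charpoly) ∧
      ∀ x ∈ K, ∃ n : ℕ, 0 < n ∧ x ^ n ∈ H := by
  have : Nonempty (Fin d) := ⟨⟨0, hd⟩⟩
  have hfin : {ζ : ℂ | ζ ^ d = 1}.Finite := by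
    refine (Polynomial.nthRootsFinset d (1 : ℂ)).finite_toSet.subset fun ζ hζ => ?_
    exact (Polynomial.mem_nthRootsFinset hd (1 : ℂ)).2 hζ
  have := hfin.to_subtype
  let φ : K → ((Fin d × Fin d) ⊕ (Fin d × Fin d)) → ℂ := fun x =>
    Sum.elim (fun ij => x.1.1.1 ij.1 ij.2) (fun ij => x.1.2.1 ij.1 ij.2)
  let X₁ : Matrix (Fin d) (Fin d) (MvPolynomial ((Fin d × Fin d) ⊕ (Fin d × Fin d)) ℂ) :=
    Matrix.of fun i j => MvPolynomial.X (Sum.inl (i, j))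
  let X₂ : Matrix (Fin d) (Fin d) (MvPolynomial ((Fin d × Fin d) ⊕ (Fin d × Fin d)) ℂ) :=
    Matrix.of fun i j => MvPolynomial.X (Sum.inr (i, j))
  let δ (t c : ℂ)
      (Y : Matrix (Fin d) (Fin d) (MvPolynomial ((Fin d × Fin d) ⊕ (Fin d × Fin d)) ℂ)) :
      MvPolynomial ((Fin d × Fin d) ⊕ (Fin d × Fin d)) ℂ :=
    (Matrix.scalar (Fin d) (MvPolynomial.C t) -
      (MvPolynomial.C c : MvPolynomial ((Fin d × Fin d) ⊕ (Fin d × Fin d)) ℂ) • Y).det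
  have hδ : ∀ (t c : ℂ) (x : K) Y, MvPolynomial.eval (φ x) (δ t c Y) =
      (Matrix.scalar (Fin d) t - c • (MvPolynomial.eval (φ x)).mapMatrix Y).det :=
    fun t c x Y => eval_det_scalar_sub (φ x) t c Y
  have hX₁ : ∀ x : K, (MvPolynomial.eval (φ x)).mapMatrix X₁ = x.1.1.1 := by
    intro x
    ext i j
    simp [X₁, φ]
  have hX₂ : ∀ x : K, (MvPolynomial.eval (φ x)).mapMatrix X₂ = x.1.2.1 := by
    intro x
    ext i j
    simp [X₂, φ]
  obtain ⟨H, ζ, hH, hpow⟩ := exists_subgroup_subset_of_cover φ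
    (by
      rintro g (⟨i, j⟩ | ⟨i, j⟩)
      · refine ⟨∑ k, MvPolynomial.C (g.1.1.1 i k) * MvPolynomial.X (Sum.inl (k, j)), fun x => ?_⟩
        simp [φ, Matrix.mul_apply]
      · refine ⟨∑ k, MvPolynomial.C (g.1.2.1 i k) * MvPolynomial.X (Sum.inr (k, j)), fun x => ?_⟩
        simp [φ, Matrix.mul_apply])
    (by
      rintro g (⟨i, j⟩ | ⟨i, j⟩)
      · refine ⟨∑ k, MvPolynomial.X (Sum.inl (i, k)) * MvPolynomial.C (g.1.1.1 k j), fun x => ?_⟩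
        simp [φ, Matrix.mul_apply]
      · refine ⟨∑ k, MvPolynomial.X (Sum.inr (i, k)) * MvPolynomial.C (g.1.2.1 k j), fun x => ?_⟩
        simp [φ, Matrix.mul_apply])
    (fun (ζ : {ζ : ℂ | ζ ^ d = 1}) => {x : K | x.1.1.1.charpoly = (ζ.1 • x.1.2.1).charpoly})
    -- Equality of characteristic polynomials is imposed value by value: one polynomial equation in
    -- the entries for each `t`.
    (fun ζ => ⟨Set.range fun t : ℂ => δ t 1 X₁ - δ t ζ.1 X₂, by
      ext x
      simp only [Set.mem_ofPred_eq, charpoly_eq_iff_forall_det, Set.forall_mem_range, map_sub,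
        hδ, hX₁, hX₂, one_smul, sub_eq_zero]⟩)
    (fun x => by
      obtain ⟨ζ, h1, h2⟩ := hK x.1 x.2
      exact ⟨⟨ζ, h1⟩, h2⟩)
  -- The identity lies in `H`; comparing the characteristic polynomials of `1` and `ζ • 1` at `ζ`
  -- gives `(ζ - 1) ^ d = 0`.
  have hζ : ζ.1 = 1 := by
    have h := charpoly_eq_iff_forall_det.1 (hH 1 (one_mem H)) ζ.1
    have e1 : Matrix.scalar (Fin d) ζ.1 - (1 : Matrix (Fin d) (Fin d) ℂ) =
        (ζ.1 - 1) • (1 : Matrix (Fin d) (Fin d) ℂ) := by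
      ext i j
      by_cases h : i = j <;> simp [h]
    have e2 : Matrix.scalar (Fin d) ζ.1 - ζ.1 • (1 : Matrix (Fin d) (Fin d) ℂ) = 0 := by
      ext i j
      by_cases h : i = j <;> simp [h]
    change (Matrix.scalar (Fin d) ζ.1 - (1 : Matrix (Fin d) (Fin d) ℂ)).det =
      (Matrix.scalar (Fin d) ζ.1 - ζ.1 • (1 : Matrix (Fin d) (Fin d) ℂ)).det at h
    rw [e1, e2, Matrix.det_smul, Matrix.det_one, mul_one, Matrix.det_zero] at h
    exact sub_eq_zero.1 (pow_eq_zero_iff (by simpa using hd.ne') |>.1 h)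
  refine ⟨H.map K.subtype, ?_, ?_, ?_⟩
  · rintro _ ⟨x, -, rfl⟩
    exact x.2
  · rintro _ ⟨x, hx, rfl⟩
    have h : x.1.1.1.charpoly = (ζ.1 • x.1.2.1).charpoly := hH x hx
    rwa [hζ, one_smul] at h
  · intro x hx
    obtain ⟨n, hn, h⟩ := hpow ⟨x, hx⟩
    exact ⟨n, hn, ⟨_, h, rfl⟩⟩

end Ratio

/-! ### Invariant subspaces of powers -/

section Intertwiner

variable {Γ : Type*} [Group Γ] {d : ℕ}

theorem exists_smul_one_of_proj_eq_one {A : SLC d} (h : proj d A = 1) :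
    ∃ c : ℂ, c ^ d = 1 ∧ A.1 = c • (1 : Matrix (Fin d) (Fin d) ℂ) :=
  exists_smul_of_proj_eq (B := 1) (by rw [h, map_one])

/-- A subspace stable under a power of each lift is invariant. -/
theorem isInvariantSubspace_of_pow {ρ : Γ →* PSLC d}
    (hρ : ∀ γ : Γ, γ ≠ 1 → HasDistinctModuli (ρ γ)) {W : Submodule ℂ (Fin d → ℂ)}
    (hW : ∀ (γ : Γ) (A : SLC d), proj d A = ρ γ →
      ∃ n : ℕ, 0 < n ∧ ∀ w ∈ W, (A.1 ^ n).mulVec w ∈ W) : IsInvariantSubspace ρ W := by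
  intro γ A hA w hw
  rw [Submodule.mem_comap, Matrix.toLin'_apply]
  by_cases hγ : γ = 1
  · rw [hγ, map_one] at hA
    obtain ⟨c, -, hc⟩ := exists_smul_one_of_proj_eq_one hA
    rw [hc, Matrix.smul_mulVec, Matrix.one_mulVec]
    exact W.smul_mem c hw
  · have h := hρ γ hγ
    rw [← hA] at h
    obtain ⟨P, l, hl, hAl⟩ := h.exists_conjMat
    obtain ⟨n, hn, hWn⟩ := hW γ A hA
    obtain ⟨q, hq⟩ := exists_aeval_pow hl hn
    have hAq : A.1 = Polynomial.aeval (A.1 ^ n) q := by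
      rw [hAl, conjMat_diagonal_pow, hq]
    rw [hAq]
    refine stable_adjoin (s := {A.1 ^ n}) ?_ _ (Polynomial.aeval_mem_adjoin_singleton ℂ _) w hw
    rintro _ rfl
    exact hWn

/-- Complete reducibility passes to subsets containing a power of each element, in any basis. -/
theorem IsCompletelyReducible.exists_isCompl {ρ : Γ →* PSLC d} (hcr : IsCompletelyReducible ρ)
    (hρ : ∀ γ : Γ, γ ≠ 1 → HasDistinctModuli (ρ γ)) {s : Set (SLC d)}
    (hs : ∀ A ∈ s, ∃ γ, proj d A = ρ γ)
    (hpow : ∀ (γ : Γ) (A : SLC d), proj d A = ρ γ → ∃ n : ℕ, 0 < n ∧ A ^ n ∈ s)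
    (P : GL (Fin d) ℂ) {R : Subalgebra ℂ (Matrix (Fin d) (Fin d) ℂ)}
    (hR : R = Algebra.adjoin ℂ ((fun A : SLC d => conjMat P⁻¹ A.1) '' s))
    (W : Submodule ℂ (Fin d → ℂ)) (hW : ∀ r ∈ R, ∀ w ∈ W, r.mulVec w ∈ W) :
    ∃ W' : Submodule ℂ (Fin d → ℂ), (∀ r ∈ R, ∀ w ∈ W', r.mulVec w ∈ W') ∧ IsCompl W W' := by
  have hPP : (P : Matrix (Fin d) (Fin d) ℂ) * ((P⁻¹ : GL (Fin d) ℂ) : Matrix _ _ ℂ) = 1 := by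
    rw [← Units.val_mul, mul_inv_cancel, Units.val_one]
  have hPP' : ((P⁻¹ : GL (Fin d) ℂ) : Matrix (Fin d) (Fin d) ℂ) * (P : Matrix _ _ ℂ) = 1 := by
    rw [← Units.val_mul, inv_mul_cancel, Units.val_one]
  let e : (Fin d → ℂ) ≃ₗ[ℂ] (Fin d → ℂ) := Matrix.toLin'OfInv hPP' hPP
  have he : ∀ v, e v = (P : Matrix (Fin d) (Fin d) ℂ).mulVec v := fun v => rfl
  have he' : ∀ v, e.symm v = ((P⁻¹ : GL (Fin d) ℂ) : Matrix (Fin d) (Fin d) ℂ).mulVec v :=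
    fun v => rfl
  have hconj : ∀ (A : Matrix (Fin d) (Fin d) ℂ) v,
      (conjMat P⁻¹ A).mulVec v = e.symm (A.mulVec (e v)) := by
    intro A v
    rw [he, he', conjMat_apply, inv_inv, Matrix.mulVec_mulVec, Matrix.mulVec_mulVec,
      Matrix.mul_assoc]
  -- In the original basis the subspace is `P W`, stable under a power of each lift and hence
  -- invariant; its complement is carried back by `P⁻¹`.
  obtain ⟨U, hU, hc⟩ := hcr (W.map (e : (Fin d → ℂ) →ₗ[ℂ] (Fin d → ℂ))) (by
    refine isInvariantSubspace_of_pow hρ fun γ A hA => ?_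
    obtain ⟨n, hn, hAn⟩ := hpow γ A hA
    refine ⟨n, hn, ?_⟩
    rintro _ ⟨w, hw, rfl⟩
    refine ⟨_, hW (conjMat P⁻¹ (A ^ n).1) ?_ w hw, ?_⟩
    · rw [hR]
      exact Algebra.subset_adjoin ⟨_, hAn, rfl⟩
    · rw [hconj]
      simp)
  refine ⟨U.map (e.symm : (Fin d → ℂ) →ₗ[ℂ] (Fin d → ℂ)), ?_, ?_⟩
  · rw [hR]
    refine stable_adjoin ?_
    rintro _ ⟨A, hA, rfl⟩ _ ⟨u, hu, rfl⟩
    obtain ⟨γ, hγ⟩ := hs A hA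
    refine ⟨A.1.mulVec u, hU γ A hγ hu, ?_⟩
    change e.symm _ = (conjMat P⁻¹ A.1).mulVec (e.symm u)
    rw [hconj, e.apply_symm_apply]
  · have h := (Submodule.orderIsoMapComap e.symm).isCompl hc
    have h1 : (Submodule.orderIsoMapComap e.symm) (W.map (e : (Fin d → ℂ) →ₗ[ℂ] (Fin d → ℂ))) =
        W := by
      ext w
      simp [Submodule.orderIsoMapComap_apply]
    rw [h1] at h
    exact h

end Intertwiner

/-! ### Rigidity -/

section Rigidity

variable {Γ : Type*} [Group Γ] {d : ℕ}

/-- The pairs of lifts of the values of two representations. -/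
def liftPairs (ρ ρ' : Γ →* PSLC d) : Subgroup (SLC d × SLC d) :=
  (ρ.prod ρ').range.comap ((proj d).prodMap (proj d))

theorem mem_liftPairs {ρ ρ' : Γ →* PSLC d} {x : SLC d × SLC d} :
    x ∈ liftPairs ρ ρ' ↔ ∃ γ, proj d x.1 = ρ γ ∧ proj d x.2 = ρ' γ := by
  refine exists_congr fun γ => ?_
  rw [Prod.ext_iff]
  exact and_congr eq_comm eq_comm

/-- For `γ = 1` the lifts are scalars and `ζ` is their quotient; otherwise `ζ` comes from the common
eigenvalue list. -/
theorem exists_charpoly_eq_smul (hd : 0 < d) {ρ ρ' : Γ →* PSLC d}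
    (hρ : ∀ γ : Γ, γ ≠ 1 → HasDistinctModuli (ρ γ))
    (hρ' : ∀ γ : Γ, γ ≠ 1 → HasDistinctModuli (ρ' γ))
    (hgap : ∀ (γ : Γ) (j : ℕ) (hj : j + 1 < d), gap (ρ γ) j hj = gap (ρ' γ) j hj) :
    ∀ x ∈ liftPairs ρ ρ', ∃ ζ : ℂ, ζ ^ d = 1 ∧ x.1.1.charpoly = (ζ • x.2.1).charpoly := by
  intro x hx
  obtain ⟨γ, h1, h2⟩ := mem_liftPairs.1 hx
  by_cases hγ : γ = 1
  · rw [hγ, map_one] at h1 h2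
    obtain ⟨a, ha, hxa⟩ := exists_smul_one_of_proj_eq_one h1
    obtain ⟨b, hb, hxb⟩ := exists_smul_one_of_proj_eq_one h2
    have hb0 : b ≠ 0 := by
      rintro rfl
      rw [zero_pow hd.ne'] at hb
      exact zero_ne_one hb
    refine ⟨a / b, by rw [div_pow, ha, hb, div_one], ?_⟩
    rw [hxa, hxb, smul_smul, div_mul_cancel₀ a hb0]
  · have e1 := hρ γ hγ
    have e2 := hρ' γ hγ
    have e3 := hgap γ
    rw [← h1] at e1
    rw [← h2] at e2
    simp only [← h1, ← h2] at e3
    obtain ⟨P, Q, l, ζ, hζ, -, hP, hQ⟩ := exists_common_eigenvalues hd e1 e2 e3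
    refine ⟨ζ, hζ, ?_⟩
    have h3 : Matrix.diagonal (fun j => ζ * l j) = ζ • Matrix.diagonal l := by
      ext a b
      by_cases h : a = b <;> simp [h]
    rw [hP, hQ, ← map_smul, charpoly_conjMat, charpoly_conjMat, h3]

theorem trace_eq_of_charpoly_eq (hd : 0 < d) {A B : Matrix (Fin d) (Fin d) ℂ}
    (h : A.charpoly = B.charpoly) : A.trace = B.trace := by
  have : Nonempty (Fin d) := ⟨⟨0, hd⟩⟩
  rw [Matrix.trace_eq_neg_charpoly_coeff, Matrix.trace_eq_neg_charpoly_coeff, h]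

/-- A subgroup of pairs of matrices with equal characteristic polynomials, containing an element
with distinct eigenvalues, consists of pairs conjugate by a common matrix, provided that both
projections are completely reducible in the sense of matrix coefficients. -/
theorem exists_intertwiner (hd : 0 < d) {H : Subgroup (SLC d × SLC d)}
    (hH : ∀ x ∈ H, x.1.1.charpoly = x.2.1.charpoly)
    {P Q : GL (Fin d) ℂ} {m : Fin d → ℂ} (hm : Function.Injective m)
    {x₀ : SLC d × SLC d} (hx₀ : x₀ ∈ H) (h₁ : x₀.1.1 = conjMat P (Matrix.diagonal m))
    (h₂ : x₀.2.1 = conjMat Q (Matrix.diagonal m))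
    (hcr₁ : ∀ R : Subalgebra ℂ (Matrix (Fin d) (Fin d) ℂ),
      R = Algebra.adjoin ℂ ((fun A : SLC d => conjMat P⁻¹ A.1) '' (Prod.fst '' (H : Set (SLC d × SLC d)))) →
      ∀ W : Submodule ℂ (Fin d → ℂ), (∀ r ∈ R, ∀ w ∈ W, r.mulVec w ∈ W) →
      ∃ W' : Submodule ℂ (Fin d → ℂ), (∀ r ∈ R, ∀ w ∈ W', r.mulVec w ∈ W') ∧ IsCompl W W')
    (hcr₂ : ∀ R : Subalgebra ℂ (Matrix (Fin d) (Fin d) ℂ),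
      R = Algebra.adjoin ℂ ((fun A : SLC d => conjMat Q⁻¹ A.1) '' (Prod.snd '' (H : Set (SLC d × SLC d)))) →
      ∀ W : Submodule ℂ (Fin d → ℂ), (∀ r ∈ R, ∀ w ∈ W, r.mulVec w ∈ W) →
      ∃ W' : Submodule ℂ (Fin d → ℂ), (∀ r ∈ R, ∀ w ∈ W', r.mulVec w ∈ W') ∧ IsCompl W W') :
    ∃ T : GL (Fin d) ℂ, ∀ x ∈ H, conjMat T x.1.1 = x.2.1 := by
  let f : SLC d × SLC d →* Matrix (Fin d) (Fin d) ℂ × Matrix (Fin d) (Fin d) ℂ :=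
    { toFun := fun x => (conjMat P⁻¹ x.1.1, conjMat Q⁻¹ x.2.1)
      map_one' := by simp
      map_mul' := fun x y => by simp }
  let S : Submonoid (Matrix (Fin d) (Fin d) ℂ × Matrix (Fin d) (Fin d) ℂ) :=
    H.toSubmonoid.map f
  let R := Algebra.adjoin ℂ (S : Set (Matrix (Fin d) (Fin d) ℂ × Matrix (Fin d) (Fin d) ℂ))
  have hfR : ∀ x ∈ H, f x ∈ R := fun x hx => Algebra.subset_adjoin ⟨x, hx, rfl⟩
  have htr : ∀ r ∈ R, r.1.trace = r.2.trace := by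
    intro r hr
    -- The generators form a monoid, so the algebra is their linear span and equality of traces
    -- extends by linearity.
    have hr' : r ∈ Submodule.span ℂ
        (S : Set (Matrix (Fin d) (Fin d) ℂ × Matrix (Fin d) (Fin d) ℂ)) := by
      have h : r ∈ Subalgebra.toSubmodule R := hr
      rwa [Algebra.adjoin_eq_span, Submonoid.closure_eq] at h
    clear hr
    induction hr' using Submodule.span_induction with
    | mem y hy =>
      obtain ⟨x, hx, rfl⟩ := hy
      change (conjMat P⁻¹ x.1.1).trace = (conjMat Q⁻¹ x.2.1).trace
      rw [trace_conjMat, trace_conjMat, trace_eq_of_charpoly_eq hd (hH x hx)]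
    | zero => rfl
    | add y z _ _ hy hz =>
      rw [Prod.fst_add, Prod.snd_add, Matrix.trace_add, Matrix.trace_add, hy, hz]
    | smul c y _ hy => rw [Prod.smul_fst, Prod.smul_snd, Matrix.trace_smul, Matrix.trace_smul, hy]
  have hdiag : (Matrix.diagonal m, Matrix.diagonal m) ∈ R := by
    have h := hfR x₀ hx₀
    change (conjMat P⁻¹ x₀.1.1, conjMat Q⁻¹ x₀.2.1) ∈ R at h
    rwa [h₁, h₂, conjMat_inv_conjMat, conjMat_inv_conjMat] at h
  have hE : ∀ j, (Matrix.single j j 1, Matrix.single j j 1) ∈ R := by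
    intro j
    obtain ⟨q, hq⟩ := exists_aeval_diagonal_eq_single hm j
    have h := aeval_mem_subalgebra hdiag q
    have e : Polynomial.aeval (Matrix.diagonal m, Matrix.diagonal m) q =
        ((Matrix.single j j 1, Matrix.single j j 1) :
          Matrix (Fin d) (Fin d) ℂ × Matrix (Fin d) (Fin d) ℂ) := by
      apply Prod.ext
      · rw [← hq]
        exact (Polynomial.aeval_algHom_apply (AlgHom.fst ℂ (Matrix (Fin d) (Fin d) ℂ)
          (Matrix (Fin d) (Fin d) ℂ)) _ q).symm
      · rw [← hq]
        exact (Polynomial.aeval_algHom_apply (AlgHom.snd ℂ (Matrix (Fin d) (Fin d) ℂ)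
          (Matrix (Fin d) (Fin d) ℂ)) _ q).symm
    rwa [e] at h
  have hR₁ : R.map (AlgHom.fst ℂ _ _) = Algebra.adjoin ℂ
      ((fun A : SLC d => conjMat P⁻¹ A.1) '' (Prod.fst '' (H : Set (SLC d × SLC d)))) := by
    rw [AlgHom.map_adjoin]
    congr 1
    simp only [S, Submonoid.coe_map, Set.image_image]
    rfl
  have hR₂ : R.map (AlgHom.snd ℂ _ _) = Algebra.adjoin ℂ
      ((fun A : SLC d => conjMat Q⁻¹ A.1) '' (Prod.snd '' (H : Set (SLC d × SLC d)))) := by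
    rw [AlgHom.map_adjoin]
    congr 1
    simp only [S, Submonoid.coe_map, Set.image_image]
    rfl
  obtain ⟨c, hc0, hc⟩ := exists_diagonal_intertwiner R htr hE
    (by
      rintro j k ⟨r, hr, hr0⟩
      obtain ⟨_, ⟨s, hs, rfl⟩, hs0⟩ := Reach.symm (R := R.map (AlgHom.fst ℂ _ _))
        (fun j => ⟨_, hE j, rfl⟩) (hcr₁ _ hR₁) ⟨_, ⟨r, hr, rfl⟩, hr0⟩
      exact ⟨s, hs, hs0⟩)
    (by
      rintro j k ⟨r, hr, hr0⟩
      obtain ⟨_, ⟨s, hs, rfl⟩, hs0⟩ := Reach.symm (R := R.map (AlgHom.snd ℂ _ _))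
        (fun j => ⟨_, hE j, rfl⟩) (hcr₂ _ hR₂) ⟨_, ⟨r, hr, rfl⟩, hr0⟩
      exact ⟨s, hs, hs0⟩)
  let C : GL (Fin d) ℂ :=
    { val := Matrix.diagonal c
      inv := Matrix.diagonal fun j => (c j)⁻¹
      val_inv := by simp [Matrix.diagonal_mul_diagonal, hc0]
      inv_val := by simp [Matrix.diagonal_mul_diagonal, hc0] }
  -- Change to the eigenbasis of the first side, apply the diagonal intertwiner, and leave the
  -- eigenbasis of the second.
  refine ⟨Q * C * P⁻¹, fun x hx => ?_⟩
  have h : conjMat C (conjMat P⁻¹ x.1.1) = conjMat Q⁻¹ x.2.1 := by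
    ext j k
    have h := hc _ (hfR x hx) j k
    change (conjMat Q⁻¹ x.2.1) j k * c k = c j * (conjMat P⁻¹ x.1.1) j k at h
    change (Matrix.diagonal c * conjMat P⁻¹ x.1.1 * Matrix.diagonal fun j => (c j)⁻¹) j k = _
    rw [Matrix.mul_diagonal, Matrix.diagonal_mul, ← h, mul_inv_cancel_right₀ (hc0 k)]
  rw [conjMat_mul, conjMat_mul, h, conjMat_conjMat_inv]

/-- Since `‖ζ‖ = 1`, the lists `(ζ * l j) ^ n` and `l j ^ n` are both ordered by decreasing modulus.
Equal characteristic polynomials on `H` identify them, so the root of unity is gone after taking the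
power. -/
theorem exists_common_power (hd : 0 < d) {H : Subgroup (SLC d × SLC d)}
    (hH : ∀ x ∈ H, x.1.1.charpoly = x.2.1.charpoly) {x : SLC d × SLC d} {n : ℕ} (hn : 0 < n)
    (hx : x ^ n ∈ H) {P Q : GL (Fin d) ℂ} {l : Fin d → ℂ} {ζ : ℂ} (hζ : ζ ^ d = 1)
    (hl : StrictAnti (fun j => ‖l j‖))
    (h₁ : x.1.1 = conjMat P (Matrix.diagonal fun j => ζ * l j))
    (h₂ : x.2.1 = conjMat Q (Matrix.diagonal l)) :
    (x ^ n).1.1 = conjMat P (Matrix.diagonal fun j => l j ^ n) ∧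
      (x ^ n).2.1 = conjMat Q (Matrix.diagonal fun j => l j ^ n) := by
  have e1 : (x ^ n).1.1 = conjMat P (Matrix.diagonal fun j => (ζ * l j) ^ n) := by
    rw [← conjMat_diagonal_pow, ← h₁]
    simp
  have e2 : (x ^ n).2.1 = conjMat Q (Matrix.diagonal fun j => l j ^ n) := by
    rw [← conjMat_diagonal_pow, ← h₂]
    simp
  refine ⟨?_, e2⟩
  have hζ1 : ‖ζ‖ = 1 := Complex.norm_eq_one_of_pow_eq_one hζ hd.ne'
  have hl' : StrictAnti (fun j => ‖ζ * l j‖) := by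
    simpa only [norm_mul, hζ1, one_mul] using hl
  have h := hH _ hx
  rw [e1, e2] at h
  rw [e1, eq_of_charpoly_conjMat_diagonal P Q (strictAnti_norm_pow hl' hn)
    (strictAnti_norm_pow hl hn) h]

/-- Completely reducible representations with distinct moduli and the same gaps are conjugate. -/
theorem areConjugate_of_gap_eq {ρ ρ' : Γ →* PSLC d}
    (hρ : ∀ γ : Γ, γ ≠ 1 → HasDistinctModuli (ρ γ))
    (hρ' : ∀ γ : Γ, γ ≠ 1 → HasDistinctModuli (ρ' γ))
    (hgap : ∀ (γ : Γ) (j : ℕ) (hj : j + 1 < d), gap (ρ γ) j hj = gap (ρ' γ) j hj)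
    (hcr : IsCompletelyReducible ρ) (hcr' : IsCompletelyReducible ρ') : AreConjugate ρ ρ' := by
  by_cases htriv : ∀ γ : Γ, γ = 1
  · exact ⟨1, MonoidHom.ext fun γ => by rw [htriv γ, map_one, map_one]⟩
  push Not at htriv
  obtain ⟨γ₀, hγ₀⟩ := htriv
  rcases Nat.eq_zero_or_pos d with rfl | hd
  · refine ⟨1, MonoidHom.ext fun γ => ?_⟩
    obtain ⟨A, hA⟩ := proj_surjective (ρ' γ)
    obtain ⟨B, hB⟩ := proj_surjective (conjRep 1 ρ γ)
    rw [← hA, ← hB]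
    exact proj_eq_of_smul (c := 1) (Subsingleton.elim _ _)
  obtain ⟨H, hHK, hH, hpow⟩ := exists_subgroup_charpoly_eq hd (liftPairs ρ ρ')
    (exists_charpoly_eq_smul hd hρ hρ' hgap)
  have hlift : ∀ γ, γ ≠ 1 → ∀ A A' : SLC d, proj d A = ρ γ → proj d A' = ρ' γ →
      ∃ (P Q : GL (Fin d) ℂ) (l : Fin d → ℂ) (ζ : ℂ) (n : ℕ), 0 < n ∧
        StrictAnti (fun j => ‖l j‖) ∧
        A.1 = conjMat P (Matrix.diagonal fun j => ζ * l j) ∧ A'.1 = conjMat Q (Matrix.diagonal l) ∧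
        (A, A') ^ n ∈ H ∧ ((A, A') ^ n).1.1 = conjMat P (Matrix.diagonal fun j => l j ^ n) ∧
        ((A, A') ^ n).2.1 = conjMat Q (Matrix.diagonal fun j => l j ^ n) := by
    intro γ hγ A A' hA hA'
    obtain ⟨P, Q, l, ζ, hζ, hl, hP, hQ⟩ := exists_common_eigenvalues (A := A) (A' := A') hd
      (hA ▸ hρ γ hγ) (hA' ▸ hρ' γ hγ) (hA ▸ hA' ▸ hgap γ)
    obtain ⟨n, hn, hnH⟩ := hpow (A, A') (mem_liftPairs.2 ⟨γ, hA, hA'⟩)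
    exact ⟨P, Q, l, ζ, n, hn, hl, hP, hQ, hnH,
      exists_common_power hd hH hn hnH hζ hl hP hQ⟩
  obtain ⟨A₀, hA₀⟩ := proj_surjective (ρ γ₀)
  obtain ⟨A₀', hA₀'⟩ := proj_surjective (ρ' γ₀)
  obtain ⟨P, Q, l, -, n, hn, hl, -, -, hxH, hx₁, hx₂⟩ := hlift γ₀ hγ₀ A₀ A₀' hA₀ hA₀'
  obtain ⟨T, hT⟩ := exists_intertwiner hd hH
    (fun i j hij => (strictAnti_norm_pow hl hn).injective (congrArg norm hij)) hxH hx₁ hx₂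
    (fun R hR => hcr.exists_isCompl hρ
      (by
        rintro _ ⟨x, hx, rfl⟩
        obtain ⟨γ, h, -⟩ := mem_liftPairs.1 (hHK hx)
        exact ⟨γ, h⟩)
      (by
        intro γ A hA
        obtain ⟨A', hA'⟩ := proj_surjective (ρ' γ)
        obtain ⟨n, hn, h⟩ := hpow (A, A') (mem_liftPairs.2 ⟨γ, hA, hA'⟩)
        exact ⟨n, hn, _, h, rfl⟩) P hR)
    (fun R hR => hcr'.exists_isCompl hρ'
      (by
        rintro _ ⟨x, hx, rfl⟩
        obtain ⟨γ, -, h⟩ := mem_liftPairs.1 (hHK hx)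
        exact ⟨γ, h⟩)
      (by
        intro γ A' hA'
        obtain ⟨A, hA⟩ := proj_surjective (ρ γ)
        obtain ⟨n, hn, h⟩ := hpow (A, A') (mem_liftPairs.2 ⟨γ, hA, hA'⟩)
        exact ⟨n, hn, _, h, rfl⟩) Q hR)
  obtain ⟨M, hM⟩ := exists_specialLinear_conjMat T
  refine ⟨proj d M, MonoidHom.ext fun γ => ?_⟩
  by_cases hγ : γ = 1
  · rw [hγ, map_one, map_one]
  obtain ⟨A, hA⟩ := proj_surjective (ρ γ)
  obtain ⟨A', hA'⟩ := proj_surjective (ρ' γ)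
  obtain ⟨P, Q, l, ζ, n, hn, hl, hP, hQ, hxH, hx₁, hx₂⟩ := hlift γ hγ A A' hA hA'
  obtain ⟨q, hq⟩ := exists_aeval_pow hl hn
  -- Applying the same `q` to both `n`-th powers extends the intertwining from `H` to the lifts, up
  -- to the scalar `ζ` that `proj` forgets.
  have hconj : conjMat T (conjMat P (Matrix.diagonal l)) = A'.1 := by
    rw [← hq P, ← hx₁, ← Polynomial.aeval_algHom_apply, hT _ hxH, hx₂, hq Q, hQ]
  have hA2 : A.1 = ζ • conjMat P (Matrix.diagonal l) := by
    have h3 : Matrix.diagonal (fun j => ζ * l j) = ζ • Matrix.diagonal l := by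
      ext a b
      by_cases h : a = b <;> simp [h]
    rw [hP, h3, map_smul]
  have hfin : proj d (M * A * M⁻¹) = proj d A' :=
    proj_eq_of_smul (c := ζ) (by rw [hM, hA2, map_smul, hconj])
  rw [← hA', ← hfin, map_mul, map_mul, map_inv, hA]
  rfl

/-- Representations with distinct moduli and the same gaps define the same point of the character
variety. -/
theorem sameCharacterPoint_of_gap_eq {ρ ρ' : Γ →* PSLC d}
    (hρ : ∀ γ : Γ, γ ≠ 1 → HasDistinctModuli (ρ γ))
    (hρ' : ∀ γ : Γ, γ ≠ 1 → HasDistinctModuli (ρ' γ))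
    (hgap : ∀ (γ : Γ) (j : ℕ) (hj : j + 1 < d), gap (ρ γ) j hj = gap (ρ' γ) j hj) :
    SameCharacterPoint ρ ρ' := by
  by_cases htriv : ∀ γ : Γ, γ = 1
  · have h : ρ = ρ' := MonoidHom.ext fun γ => by rw [htriv γ, map_one, map_one]
    exact fun F _ _ => by rw [h]
  push Not at htriv
  obtain ⟨γ₀, hγ₀⟩ := htriv
  -- Semisimplification keeps characteristic polynomials, hence distinct moduli and gaps, so the
  -- conjugacy theorem applies to the two semisimplifications.
  have key : ∀ ρ : Γ →* PSLC d, (∀ γ : Γ, γ ≠ 1 → HasDistinctModuli (ρ γ)) →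
      ∃ σ : Γ →* PSLC d, IsCompletelyReducible σ ∧
        (∀ γ : Γ, γ ≠ 1 → HasDistinctModuli (σ γ)) ∧
        (∀ (γ : Γ) (j : ℕ) (hj : j + 1 < d), gap (σ γ) j hj = gap (ρ γ) j hj) ∧
        ∀ F ∈ regularFunctions Γ d, (∀ (M : PSLC d) (τ : Γ →* PSLC d), F (conjRep M τ) = F τ) →
          F σ = F ρ := by
    intro ρ hρ
    obtain ⟨σ, hσ, hchar, hF⟩ := exists_semisimplification ρ (hρ γ₀ hγ₀)
    have hboth : ∀ γ, γ ≠ 1 → HasDistinctModuli (σ γ) ∧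
        ∀ (j : ℕ) (hj : j + 1 < d), gap (σ γ) j hj = gap (ρ γ) j hj := by
      intro γ hγ
      obtain ⟨A, B, hA, hB, h⟩ := hchar γ
      have hd := hρ γ hγ
      rw [← hA] at hd
      rw [← hA, ← hB]
      exact hd.of_charpoly_eq h
    refine ⟨σ, hσ, fun γ hγ => (hboth γ hγ).1, fun γ => ?_, hF⟩
    by_cases hγ : γ = 1
    · intro j hj
      rw [hγ, map_one, map_one]
    · exact (hboth γ hγ).2
  obtain ⟨σ, hσ, hdm, hg, hF⟩ := key ρ hρ
  obtain ⟨σ', hσ', hdm', hg', hF'⟩ := key ρ' hρ'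
  obtain ⟨M, hM⟩ := areConjugate_of_gap_eq hdm hdm'
    (fun γ j hj => (hg γ j hj).trans ((hgap γ j hj).trans (hg' γ j hj).symm)) hσ hσ'
  intro F hFreg hinv
  rw [← hF F hFreg hinv, ← hF' F hFreg hinv, hM, hinv]

end Rigidity

end SurfaceRep

theorem mainTheorem9 {S : Type*} [TopologicalSpace S] [T2Space S] [CompactSpace S]
    [ConnectedSpace S] [ChartedSpace (EuclideanSpace ℝ (Fin 2)) S] [IsManifold (𝓡 2) ∞ S]
    (hS : SurfaceRep.IsOrientable S) (x : S) (d : ℕ)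
    (ρ ρ' : FundamentalGroup S x →* SurfaceRep.PSLC d)
    (hρ : ∀ γ : FundamentalGroup S x, γ ≠ 1 → SurfaceRep.HasDistinctModuli (ρ γ))
    (hρ' : ∀ γ : FundamentalGroup S x, γ ≠ 1 → SurfaceRep.HasDistinctModuli (ρ' γ))
    (hgap : ∀ (γ : FundamentalGroup S x) (j : ℕ) (hj : j + 1 < d),
      SurfaceRep.gap (ρ γ) j hj = SurfaceRep.gap (ρ' γ) j hj) :
    SurfaceRep.SameCharacterPoint ρ ρ' ∧
    (SurfaceRep.IsCompletelyReducible ρ → SurfaceRep.IsCompletelyReducible ρ' →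
      SurfaceRep.AreConjugate ρ ρ') :=
  ⟨SurfaceRep.sameCharacterPoint_of_gap_eq hρ hρ' hgap,
    SurfaceRep.areConjugate_of_gap_eq hρ hρ' hgap⟩
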